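/- Let $M\ge 1$, $d\ge 0$, and let $g:(0,\infty)\to[0,\infty)$ be differentiable with $0<\delta_{M,g}:=\int_0^\infty t^{M-1}g(t)\,dt<\infty$. Put $\phi(t)=g'(t)/g(t)$ (with $\phi(t)=0$ where $g(t)=0$), and let $\mathcal Q$ be a random variable on $(0,\infty)$ with density $\delta_{M,g}^{-1}t^{M-1}g(t)$ (the second-order modular variate). Assume $\mathrm E[\mathcal Q\phi^2(\mathcal Q)]<\infty$ and $\mathrm E[\mathcal Q^2\phi^2(\mathcal Q)]<\infty$. Let $\Theta\subseteq\mathbb R^d$ be open, and for each $\boldsymbol\alpha\in\Theta$ let $\boldsymbol\mu(\boldsymbol\alpha)\in\mathbb C^M$ and $\boldsymbol\Sigma(\boldsymbol\alpha),\boldsymbol\Omega(\boldsymbol\alpha)\in\mathbb C^{M\times M}$ be such that the extended scatter matrix $$\widetilde{\boldsymbol\Gamma}(\boldsymbol\alpha)=\begin{pmatrix}\boldsymbol\Sigma&\boldsymbol\Omega\\ \boldsymbol\Omega^*&\boldsymbol\Sigma^*\end{pmatrix}$$ ($^*$ denotes entrywise conjugation) is Hermitian positive definite. For $\mathbf z\in\mathbb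 C^M$ write $\tilde{\mathbf z}=(\mathbf z^T,\mathbf z^H)^T$, and $\tilde{\boldsymbol\mu}=(\boldsymbol\mu^T,\boldsymbol\mu^H)^T$. The noncircular complex elliptically symmetric (NC-CES) distribution with parameter $\boldsymbol\alpha$ and density generator $g$ has density with respect to Lebesgue measure on $\mathbb C^M$ $$p(\mathbf z;\boldsymbol\alpha)=\frac{\Gamma(M)}{\pi^M\delta_{M,g}}\,|\widetilde{\boldsymbol\Gamma}|^{-1/2}\,g\Big(\tfrac12(\tilde{\mathbf z}-\tilde{\boldsymbol\mu})^H\widetilde{\boldsymbol\Gamma}^{-1}(\tilde{\mathbf z}-\tilde{\boldsymbol\mu})\Big).$$ Let $\boldsymbol\alpha\in\Theta$ be a point at which all the partial derivatives of (the entries of) $\boldsymbol\mu,\boldsymbol\Sigma,\boldsymbol\Omega$ exist, and write $\tilde{\boldsymbol\mu}_k=\partial\tilde{\boldsymbol\mu}/\partial\alpha_k$ and $\widetilde{\boldsymbol\Gamma}_k=\partial\widetilde{\boldsymbol\Gamma}/\partial\alpha_k$ at this point. Let $\mathbf z$ have the density $p(\cdot;\boldsymbol\alpha)$. Then $p(\cdot;\boldsymbol\alpha)$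 is indeed a probability density, the scores $\partial\log p(\mathbf z;\boldsymbol\alpha)/\partial\alpha_k$ exist almost surely and are integrable with $$\mathrm E\Big[\frac{\partial\log p(\mathbf z;\boldsymbol\alpha)}{\partial\alpha_k}\Big]=0\qquad(1\le k\le d),$$ their pairwise products are integrable, and for all $1\le k,l\le d$ the Fisher information matrix satisfies $$[\mathbf I^{\rm NC}_{\rm CES}]_{k,l}:=\mathrm E\Big[\frac{\partial\log p(\mathbf z;\boldsymbol\alpha)}{\partial\alpha_k}\frac{\partial\log p(\mathbf z;\boldsymbol\alpha)}{\partial\alpha_l}\Big]=\frac{\mathrm E[\mathcal Q\phi^2(\mathcal Q)]}{M}\,\mathrm{Re}\big(\tilde{\boldsymbol\mu}_k^H\widetilde{\boldsymbol\Gamma}^{-1}\tilde{\boldsymbol\mu}_l\big)$$ $$+\frac{\mathrm E[\mathcal Q^2\phi^2(\mathcal Q)]}{4M(M+1)}\Big(\mathrm{tr}(\widetilde{\boldsymbol\Gamma}_k\widetilde{\boldsymbol\Gamma}^{-1})\,\mathrm{tr}(\widetilde{\boldsymbol\Gamma}_l\widetilde{\boldsymbol\Gamma}^{-1})+2\,\mathrm{tr}(\widetilde{\boldsymbol\Gamma}_k\widetilde{\boldsymbol\Gamma}^{-1}\widetilde{\boldsymbol\Gamma}_l\widetilde{\boldsymbol\Gamma}^{-1})\Big)-\frac14\,\mathrm{tr}(\widetilde{\boldsymbol\Gamma}^{-1}\widetilde{\boldsymbol\Gamma}_k)\,\mathrm{tr}(\widetilde{\boldsymbol\Gamma}^{-1}\widetilde{\boldsymbol\Gamma}_l).$$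 -/

import Mathlib

open MeasureTheory Matrix
open scoped ComplexOrder

noncomputable section

namespace NCCES

/-- The augmented vector `(zᵀ, zᴴ)ᵀ` of a vector `z` of `ℂ^M`. -/
def aug {M : ℕ} (z : Fin M → ℂ) : Fin M ⊕ Fin M → ℂ :=
  Sum.elim z (star z)

/-- The extended scatter matrix with first block row `(S, W)` and second block row
`(conj W, conj S)`, where `S` is the scatter matrix and `W` is the pseudo-scatter matrix. -/
def augScatter {M : ℕ} (S W : Matrix (Fin M) (Fin M) ℂ) :
    Matrix (Fin M ⊕ Fin M) (Fin M ⊕ Fin M) ℂ :=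
  Matrix.fromBlocks S W (W.map star) (S.map star)

/-- The quadratic form `η = (1/2) (z - μ)ᴴ G⁻¹ (z - μ)` in augmented vectors, with `G` the extended
scatter matrix. -/
def eta {M : ℕ} (m : Fin M → ℂ) (S W : Matrix (Fin M) (Fin M) ℂ) (z : Fin M → ℂ) : ℝ :=
  (1 / 2) * (star (aug z - aug m) ⬝ᵥ ((augScatter S W)⁻¹ *ᵥ (aug z - aug m))).re

/-- `δ = ∫₀^∞ t^(M-1) g(t) dt`. -/
def delta (M : ℕ) (g : ℝ → ℝ) : ℝ :=
  ∫ t in Set.Ioi (0 : ℝ), t ^ (M - 1) * g t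

/-- The density generators in dimension `M` that are differentiable on `(0, ∞)`. Only the values
of `g` on `(0, ∞)` matter. -/
structure IsDensityGenerator (M : ℕ) (g : ℝ → ℝ) : Prop where
  nonneg : ∀ t, 0 < t → 0 ≤ g t
  differentiable : DifferentiableOn ℝ g (Set.Ioi 0)
  integrable : IntegrableOn (fun t : ℝ => t ^ (M - 1) * g t) (Set.Ioi 0)
  delta_pos : 0 < delta M g

/-- `φ = g' / g`. -/
def phi (g : ℝ → ℝ) (t : ℝ) : ℝ :=
  deriv g t / g t

/-- The area `2 π^M / Γ(M)` of the unit sphere of `ℂ^M`. -/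
def sphereArea (M : ℕ) : ℝ :=
  2 * Real.pi ^ M / Real.Gamma M

/-- The normalizing constant `2 / (s_M δ)`. -/
def normConst (M : ℕ) (g : ℝ → ℝ) : ℝ :=
  2 / (sphereArea M * delta M g)

/-- The NC-CES density `c |G|^(-1/2) g(η(z))` with respect to Lebesgue measure on `ℂ^M`. -/
def density {M : ℕ} (g : ℝ → ℝ) (m : Fin M → ℂ) (S W : Matrix (Fin M) (Fin M) ℂ)
    (z : Fin M → ℂ) : ℝ :=
  normConst M g * (augScatter S W).det.re ^ (-(1 / 2) : ℝ) * g (eta m S W z)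

/-- The NC-CES distribution on `ℂ^M`. -/
def law {M : ℕ} (g : ℝ → ℝ) (m : Fin M → ℂ) (S W : Matrix (Fin M) (Fin M) ℂ) :
    Measure (Fin M → ℂ) :=
  volume.withDensity (fun z => ENNReal.ofReal (density g m S W z))

/-- The law of the second-order modular variate `Q`, with density `δ⁻¹ t^(M-1) g(t)` on `(0, ∞)`. -/
def modularLaw (M : ℕ) (g : ℝ → ℝ) : Measure ℝ :=
  (volume.restrict (Set.Ioi 0)).withDensity
    (fun t => ENNReal.ofReal ((delta M g)⁻¹ * t ^ (M - 1) * g t))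

/-- The partial derivative `∂f/∂α_k` at `a`. -/
def pderiv {d : ℕ} {F : Type*} [NormedAddCommGroup F] [NormedSpace ℝ F] (k : Fin d)
    (f : (Fin d → ℝ) → F) (a : Fin d → ℝ) : F :=
  lineDeriv ℝ f a (Pi.single k 1)

/-- Existence of the partial derivative `∂f/∂α_k` at `a`. -/
def HasPartial {d : ℕ} {F : Type*} [NormedAddCommGroup F] [NormedSpace ℝ F] (k : Fin d)
    (f : (Fin d → ℝ) → F) (a : Fin d → ℝ) : Prop :=
  LineDifferentiableAt ℝ f a (Pi.single k 1)

/-- The partial derivative of the augmented location vector. -/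
def dMu {M d : ℕ} (k : Fin d) (m : (Fin d → ℝ) → Fin M → ℂ) (a : Fin d → ℝ) :
    Fin M ⊕ Fin M → ℂ :=
  fun i => pderiv k (fun b => aug (m b) i) a

/-- The entrywise partial derivative of the extended scatter matrix. -/
def dGamma {M d : ℕ} (k : Fin d) (S W : (Fin d → ℝ) → Matrix (Fin M) (Fin M) ℂ)
    (a : Fin d → ℝ) : Matrix (Fin M ⊕ Fin M) (Fin M ⊕ Fin M) ℂ :=
  Matrix.of fun i j => pderiv k (fun b => augScatter (S b) (W b) i j) a

/-- The log-likelihood `log p(z; a)`. -/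
def logLik {M d : ℕ} (g : ℝ → ℝ) (m : (Fin d → ℝ) → Fin M → ℂ)
    (S W : (Fin d → ℝ) → Matrix (Fin M) (Fin M) ℂ) (z : Fin M → ℂ) (a : Fin d → ℝ) : ℝ :=
  Real.log (density g (m a) (S a) (W a) z)

/-- The score `∂ log p(z; a) / ∂α_k`. -/
def score {M d : ℕ} (g : ℝ → ℝ) (m : (Fin d → ℝ) → Fin M → ℂ)
    (S W : (Fin d → ℝ) → Matrix (Fin M) (Fin M) ℂ) (a : Fin d → ℝ) (k : Fin d)
    (z : Fin M → ℂ) : ℝ :=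
  pderiv k (logLik g m S W z) a

/-- The Fisher information matrix `E[(∂ log p / ∂α_k) (∂ log p / ∂α_l)]`. -/
def fisherInfo {M d : ℕ} (g : ℝ → ℝ) (m : (Fin d → ℝ) → Fin M → ℂ)
    (S W : (Fin d → ℝ) → Matrix (Fin M) (Fin M) ℂ) (a : Fin d → ℝ) :
    Matrix (Fin d) (Fin d) ℝ :=
  Matrix.of fun k l =>
    ∫ z, score g m S W a k z * score g m S W a l z ∂(law g (m a) (S a) (W a))

end NCCES

end

/-! The proof whitens the model to a spherical one. Let `T = realToAug M` send `(Re z, Im z)` to the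
augmented vector, so that `T * Tᴴ = 2`, and let `P` be the positive square root of the extended
scatter matrix `G`. Conjugation acts on `G` as the swap of the two blocks. By uniqueness of `P` it
acts on `P` in the same way, so `R = T⁻¹ * P * T` is real, `det R ^ 2 = det G`, and `C = T * R`
satisfies `C * Cᴴ = 2 • G` (`exists_whitening`). Under the real affine map `z = μ + R w`, `η`
becomes `‖w‖²`, and the law is the image of the spherical law with density proportional to `g
(‖w‖²)` (`law_eq_map`).

In these coordinates the score is `-tr A - 2 φ(‖w‖²) (⟪β, w⟫ + wᵀ A w)`, where `β = C⁻¹ μ_k` and `A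
= C⁻¹ Γ_k C⁻¹ᴴ` are real and `A` is symmetric. Rotation invariance determines the weighted second
and fourth moments of `w` up to one constant each and kills the odd cross terms. Polar coordinates
turn the constants into `E[Q φ²]` and `E[Q² φ²]`, as `‖w‖²` has the law of `Q`.

Partial integration gives `E[Q φ(Q)] = -M`. It makes the mean score vanish and produces the final
`-1/4` term, so differentiation under the integral sign is never needed. The two moment hypotheses
put the score in `L²`, which settles all integrability. -/

noncomputable section

namespace NCCES

/-! ### Moments of rotation invariant measures -/

section RotationInvariant

open scoped RealInnerProductSpace

variable {F : Type*} [NormedAddCommGroup F] [InnerProductSpace ℝ F] [MeasurableSpace F]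
  [BorelSpace F]

/-- A measure that is preserved by all linear isometries. -/
def IsRotationInvariant (μ : Measure F) : Prop :=
  ∀ e : F ≃ₗᵢ[ℝ] F, MeasurePreserving e μ μ

/-- A function that is preserved by all linear isometries. -/
def IsRadial (H : F → ℝ) : Prop :=
  ∀ (e : F ≃ₗᵢ[ℝ] F) (x : F), H (e x) = H x

omit [MeasurableSpace F] [BorelSpace F] in
lemma isRadial_norm (h : ℝ → ℝ) : IsRadial (fun w : F => h ‖w‖) := fun e x => by simp

lemma IsRotationInvariant.integral_comp {μ : Measure F} (hμ : IsRotationInvariant μ)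
    (e : F ≃ₗᵢ[ℝ] F) (f : F → ℝ) : ∫ w, f (e w) ∂μ = ∫ w, f w ∂μ :=
  (hμ e).integral_comp e.toHomeomorph.measurableEmbedding f

lemma IsRotationInvariant.integral_eq_zero_of_odd {μ : Measure F} (hμ : IsRotationInvariant μ)
    {f : F → ℝ} (hf : ∀ w, f (-w) = -f w) : ∫ w, f w ∂μ = 0 := by
  have h := hμ.integral_comp (LinearIsometryEquiv.neg ℝ) f
  simp only [LinearIsometryEquiv.coe_neg, hf, integral_neg] at h
  linarith

/-- The reflection in the hyperplane orthogonal to `v - v'` takes `v` to `v'` when the norms agree,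
and it changes neither `μ` nor `H`. -/
lemma IsRotationInvariant.integral_inner_pow_eq {μ : Measure F} (hμ : IsRotationInvariant μ)
    {H : F → ℝ} (hH : IsRadial H) (p : ℕ) {v v' : F} (h : ‖v‖ = ‖v'‖) :
    ∫ w, H w * ⟪v, w⟫ ^ p ∂μ = ∫ w, H w * ⟪v', w⟫ ^ p ∂μ := by
  set e := (ℝ ∙ (v - v'))ᗮ.reflection
  have he : e v = v' := Submodule.reflection_sub h
  rw [← hμ.integral_comp e (fun w => H w * ⟪v', w⟫ ^ p)]
  refine integral_congr_ae (.of_forall fun w => ?_)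
  simp only [hH e w]
  rw [← he, e.inner_map_map]

lemma IsRotationInvariant.integral_inner_pow {μ : Measure F} (hμ : IsRotationInvariant μ)
    {H : F → ℝ} (hH : IsRadial H) (p : ℕ) {u : F} (hu : ‖u‖ = 1) (v : F) :
    ∫ w, H w * ⟪v, w⟫ ^ p ∂μ = ‖v‖ ^ p * ∫ w, H w * ⟪u, w⟫ ^ p ∂μ := by
  rw [hμ.integral_inner_pow_eq hH p (v' := ‖v‖ • u) (by simp [norm_smul, hu]),
    ← integral_const_mul]
  refine integral_congr_ae (.of_forall fun w => ?_)
  simp only [real_inner_smul_left]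
  ring

/-- Polarization: the moment of `⟪v, w⟫ ^ 2` depends on `v` only through `‖v‖ ^ 2`. -/
lemma IsRotationInvariant.integral_inner_mul_inner {μ : Measure F} (hμ : IsRotationInvariant μ)
    {H : F → ℝ} (hH : IsRadial H) {u : F} (hu : ‖u‖ = 1)
    (hint : ∀ a b : F, Integrable (fun w => H w * (⟪a, w⟫ * ⟪b, w⟫)) μ) (a b : F) :
    ∫ w, H w * (⟪a, w⟫ * ⟪b, w⟫) ∂μ = (∫ w, H w * ⟪u, w⟫ ^ 2 ∂μ) * ⟪a, b⟫ := by
  have hint2 : ∀ v : F, Integrable (fun w => H w * ⟪v, w⟫ ^ 2) μ := fun v => by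
    simpa only [pow_two] using hint v v
  have h1 := hμ.integral_inner_pow hH 2 hu (a + b)
  have h2 := hμ.integral_inner_pow hH 2 hu (a - b)
  have h3 : ∫ w, H w * (⟪a, w⟫ * ⟪b, w⟫) ∂μ =
      (1 / 4) * (∫ w, H w * ⟪a + b, w⟫ ^ 2 ∂μ - ∫ w, H w * ⟪a - b, w⟫ ^ 2 ∂μ) := by
    rw [← integral_sub (hint2 _) (hint2 _), ← integral_const_mul]
    refine integral_congr_ae (.of_forall fun w => ?_)
    simp only [inner_add_left, inner_sub_left]
    ring
  rw [h3, h1, h2, ← real_inner_self_eq_norm_sq, ← real_inner_self_eq_norm_sq]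
  simp only [inner_add_left, inner_sub_left, inner_add_right, inner_sub_right,
    real_inner_comm a b]
  ring

/-- Polarization in degree four: all moments reduce to those of `⟪v, w⟫ ^ 4`, which are multiples of
`‖v‖ ^ 4`. The three pairings coincide when all vectors equal `u`, hence the division by 3. -/
lemma IsRotationInvariant.integral_inner_mul_inner_mul_inner_mul_inner {μ : Measure F}
    (hμ : IsRotationInvariant μ) {H : F → ℝ} (hH : IsRadial H) {u : F} (hu : ‖u‖ = 1)
    (hint : ∀ a b c d : F,
      Integrable (fun w => H w * ((⟪a, w⟫ * ⟪b, w⟫) * (⟪c, w⟫ * ⟪d, w⟫))) μ) (a b c d : F) :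
    ∫ w, H w * ((⟪a, w⟫ * ⟪b, w⟫) * (⟪c, w⟫ * ⟪d, w⟫)) ∂μ =
      (∫ w, H w * ⟪u, w⟫ ^ 4 ∂μ) / 3 *
        (⟪a, b⟫ * ⟪c, d⟫ + ⟪a, c⟫ * ⟪b, d⟫ + ⟪a, d⟫ * ⟪b, c⟫) := by
  have hint4 : ∀ v : F, Integrable (fun w => H w * ⟪v, w⟫ ^ 4) μ := fun v => by
    convert hint v v v v using 2
    ring
  obtain ⟨κ, hκ⟩ : ∃ κ, ∫ w, H w * ⟪u, w⟫ ^ 4 ∂μ = κ := ⟨_, rfl⟩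
  have h4 : ∀ v : F, ∫ w, H w * ⟪v, w⟫ ^ 4 ∂μ = ⟪v, v⟫ ^ 2 * κ := fun v => by
    rw [← hκ, hμ.integral_inner_pow hH 4 hu v, real_inner_self_eq_norm_sq]
    ring
  have h3 : ∫ w, H w * ((⟪a, w⟫ * ⟪b, w⟫) * (⟪c, w⟫ * ⟪d, w⟫)) ∂μ =
      -- The signed sum of the eight fourth powers `(a ± b ± c ± d) ^ 4` is `8 * 4! = 192` times the
      -- product.
      (1 / 192) * (((∫ w, H w * ⟪a + b + (c + d), w⟫ ^ 4 ∂μ -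
          ∫ w, H w * ⟪a + b + (c - d), w⟫ ^ 4 ∂μ) -
        (∫ w, H w * ⟪a + b - (c - d), w⟫ ^ 4 ∂μ - ∫ w, H w * ⟪a + b - (c + d), w⟫ ^ 4 ∂μ)) -
        ((∫ w, H w * ⟪a - b + (c + d), w⟫ ^ 4 ∂μ -
          ∫ w, H w * ⟪a - b + (c - d), w⟫ ^ 4 ∂μ) -
        (∫ w, H w * ⟪a - b - (c - d), w⟫ ^ 4 ∂μ -
          ∫ w, H w * ⟪a - b - (c + d), w⟫ ^ 4 ∂μ))) := by
    simp only [← integral_sub' (hint4 _) (hint4 _)]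
    rw [← integral_sub' ((hint4 _).sub (hint4 _)) ((hint4 _).sub (hint4 _)),
      ← integral_sub' ((hint4 _).sub (hint4 _)) ((hint4 _).sub (hint4 _)),
      ← integral_sub' (((hint4 _).sub (hint4 _)).sub ((hint4 _).sub (hint4 _)))
        (((hint4 _).sub (hint4 _)).sub ((hint4 _).sub (hint4 _))), ← integral_const_mul]
    refine integral_congr_ae (.of_forall fun w => ?_)
    simp only [Pi.sub_apply, inner_add_left, inner_sub_left]
    ring
  rw [h3, hκ]
  simp only [h4]
  simp only [inner_add_left, inner_sub_left, inner_add_right, inner_sub_right,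
    real_inner_comm a b, real_inner_comm a c, real_inner_comm a d, real_inner_comm b c,
    real_inner_comm b d, real_inner_comm c d]
  ring

end RotationInvariant

/-! ### Radially weighted moments of quadratic forms -/

section EuclideanMoments

variable {ι : Type*} [Fintype ι] {μ : Measure (EuclideanSpace ℝ ι)}

lemma integrable_radial_mul_coord_mul_coord {H : EuclideanSpace ℝ ι → ℝ}
    (hm : AEStronglyMeasurable H μ) (hint : Integrable (fun w => H w * ‖w‖ ^ 2) μ)
    (a b : EuclideanSpace ℝ ι) :
    Integrable (fun w => H w * (inner ℝ a w * inner ℝ b w)) μ := by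
  refine (hint.norm.const_mul (‖a‖ * ‖b‖)).mono' (hm.mul (by fun_prop)) (.of_forall fun w => ?_)
  have ha := abs_real_inner_le_norm a w
  have hb := abs_real_inner_le_norm b w
  simp only [norm_mul, norm_pow, Real.norm_eq_abs] at *
  calc |H w| * (|inner ℝ a w| * |inner ℝ b w|)
      ≤ |H w| * ((‖a‖ * ‖w‖) * (‖b‖ * ‖w‖)) := by gcongr
    _ = _ := by simp only [abs_norm]; ring

lemma integrable_radial_mul_coord_mul_coord_mul_coord_mul_coord {H : EuclideanSpace ℝ ι → ℝ}
    (hm : AEStronglyMeasurable H μ) (hint : Integrable (fun w => H w * ‖w‖ ^ 4) μ)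
    (a b c d : EuclideanSpace ℝ ι) :
    Integrable (fun w => H w * ((inner ℝ a w * inner ℝ b w) * (inner ℝ c w * inner ℝ d w))) μ := by
  refine (hint.norm.const_mul (‖a‖ * ‖b‖ * (‖c‖ * ‖d‖))).mono' (hm.mul (by fun_prop))
    (.of_forall fun w => ?_)
  have ha := abs_real_inner_le_norm a w
  have hb := abs_real_inner_le_norm b w
  have hc := abs_real_inner_le_norm c w
  have hd := abs_real_inner_le_norm d w
  simp only [norm_mul, norm_pow, Real.norm_eq_abs, abs_norm] at *
  calc |H w| * ((|inner ℝ a w| * |inner ℝ b w|) * (|inner ℝ c w| * |inner ℝ d w|))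
      ≤ |H w| * (((‖a‖ * ‖w‖) * (‖b‖ * ‖w‖)) * ((‖c‖ * ‖w‖) * (‖d‖ * ‖w‖))) := by gcongr
    _ = _ := by ring

lemma quadForm_eq_sum (B : Matrix ι ι ℝ) (w : ι → ℝ) :
    w ⬝ᵥ B *ᵥ w = ∑ i, ∑ j, B i j * (w i * w j) := by
  simp only [dotProduct, mulVec, Finset.mul_sum]
  exact Finset.sum_congr rfl fun i _ => Finset.sum_congr rfl fun j _ => by ring

variable [DecidableEq ι]

lemma IsRotationInvariant.integral_quadForm [Nonempty ι] (hμ : IsRotationInvariant μ)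
    {H : EuclideanSpace ℝ ι → ℝ} (hH : IsRadial H)
    (hm : AEStronglyMeasurable H μ) (hint : Integrable (fun w => H w * ‖w‖ ^ 2) μ)
    (B : Matrix ι ι ℝ) :
    Integrable (fun w : EuclideanSpace ℝ ι => H w * (w ⬝ᵥ B *ᵥ w)) μ ∧
    Fintype.card ι * ∫ w : EuclideanSpace ℝ ι, H w * (w ⬝ᵥ B *ᵥ w) ∂μ =
      (∫ w, H w * ‖w‖ ^ 2 ∂μ) * B.trace := by
  obtain ⟨i₀⟩ := ‹Nonempty ι›
  set e : ι → EuclideanSpace ℝ ι := fun i => EuclideanSpace.single i 1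
  have hI := integrable_radial_mul_coord_mul_coord hm hint
  have hval := hμ.integral_inner_mul_inner hH (u := e i₀) (by simp [e]) hI
  have he : ∀ i (w : EuclideanSpace ℝ ι), inner ℝ (e i) w = w i := fun i w => by
    simp [e, EuclideanSpace.inner_single_left]
  set κ := ∫ w, H w * inner ℝ (e i₀) w ^ 2 ∂μ
  have key : ∀ B : Matrix ι ι ℝ,
      Integrable (fun w : EuclideanSpace ℝ ι => H w * (w ⬝ᵥ B *ᵥ w)) μ ∧
      ∫ w : EuclideanSpace ℝ ι, H w * (w ⬝ᵥ B *ᵥ w) ∂μ = κ * B.trace := by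
    intro B
    have hexp : (fun w : EuclideanSpace ℝ ι => H w * (w ⬝ᵥ B *ᵥ w)) =
        fun w => ∑ p : ι × ι, B p.1 p.2 * (H w * (inner ℝ (e p.1) w * inner ℝ (e p.2) w)) := by
      funext w
      rw [quadForm_eq_sum, ← Finset.sum_product', Finset.univ_product_univ, Finset.mul_sum]
      refine Finset.sum_congr rfl fun p _ => ?_
      rw [he, he]
      ring
    rw [hexp]
    refine ⟨integrable_finsetSum _ fun p _ => (hI _ _).const_mul _, ?_⟩
    rw [integral_finsetSum _ fun p _ => (hI _ _).const_mul _]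
    simp_rw [integral_const_mul, hval, Fintype.sum_prod_type]
    simp [e, Matrix.trace, EuclideanSpace.inner_single_left, Finset.sum_mul, mul_comm]
  refine ⟨(key B).1, ?_⟩
  -- Taking `B = 1` identifies the unknown `κ` through the moment of `‖w‖ ^ 2`; the trace is then
  -- the dimension.
  have h1 := (key 1).2
  simp only [one_mulVec, trace_one] at h1
  have hn : ∀ w : EuclideanSpace ℝ ι, w.ofLp ⬝ᵥ w.ofLp = ‖w‖ ^ 2 := fun w => by
    rw [EuclideanSpace.real_norm_sq_eq]
    simp only [dotProduct, pow_two]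
  simp only [hn] at h1
  rw [h1, (key B).2]
  ring

/-- Of the three pairings in the fourth moment, one gives `tr B * tr C` and the others give `tr (B *
Cᵀ)` and `tr (B * C)`. Symmetry of `C` merges the last two. -/
lemma IsRotationInvariant.integral_quadForm_mul_quadForm [Nonempty ι]
    (hμ : IsRotationInvariant μ) {H : EuclideanSpace ℝ ι → ℝ} (hH : IsRadial H)
    (hm : AEStronglyMeasurable H μ) (hint : Integrable (fun w => H w * ‖w‖ ^ 4) μ)
    (B C : Matrix ι ι ℝ) (hC : Cᵀ = C) :
    Integrable (fun w : EuclideanSpace ℝ ι => H w * ((w ⬝ᵥ B *ᵥ w) * (w ⬝ᵥ C *ᵥ w))) μ ∧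
    (Fintype.card ι * (Fintype.card ι + 2)) *
        ∫ w : EuclideanSpace ℝ ι, H w * ((w ⬝ᵥ B *ᵥ w) * (w ⬝ᵥ C *ᵥ w)) ∂μ =
      (∫ w, H w * ‖w‖ ^ 4 ∂μ) * (B.trace * C.trace + 2 * (B * C).trace) := by
  obtain ⟨i₀⟩ := ‹Nonempty ι›
  set e : ι → EuclideanSpace ℝ ι := fun i => EuclideanSpace.single i 1
  have hI := integrable_radial_mul_coord_mul_coord_mul_coord_mul_coord hm hint
  have hval := hμ.integral_inner_mul_inner_mul_inner_mul_inner hH (u := e i₀) (by simp [e]) hI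
  have he : ∀ i (w : EuclideanSpace ℝ ι), inner ℝ (e i) w = w i := fun i w => by
    simp [e, EuclideanSpace.inner_single_left]
  set κ := (∫ w, H w * inner ℝ (e i₀) w ^ 4 ∂μ) / 3
  have key : ∀ B C : Matrix ι ι ℝ, Cᵀ = C →
      Integrable (fun w : EuclideanSpace ℝ ι => H w * ((w ⬝ᵥ B *ᵥ w) * (w ⬝ᵥ C *ᵥ w))) μ ∧
      ∫ w : EuclideanSpace ℝ ι, H w * ((w ⬝ᵥ B *ᵥ w) * (w ⬝ᵥ C *ᵥ w)) ∂μ =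
        κ * (B.trace * C.trace + 2 * (B * C).trace) := by
    intro B C hC
    have hexp : (fun w : EuclideanSpace ℝ ι => H w * ((w ⬝ᵥ B *ᵥ w) * (w ⬝ᵥ C *ᵥ w))) =
        fun w => ∑ p : (ι × ι) × (ι × ι), (B p.1.1 p.1.2 * C p.2.1 p.2.2) *
          (H w * ((inner ℝ (e p.1.1) w * inner ℝ (e p.1.2) w) *
            (inner ℝ (e p.2.1) w * inner ℝ (e p.2.2) w))) := by
      funext w
      rw [quadForm_eq_sum, quadForm_eq_sum, ← Finset.sum_product', ← Finset.sum_product',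
        Finset.univ_product_univ, Finset.sum_mul_sum, ← Finset.sum_product',
        Finset.univ_product_univ, Finset.mul_sum]
      refine Finset.sum_congr rfl fun p _ => ?_
      simp only [he]
      ring
    rw [hexp]
    refine ⟨integrable_finsetSum _ fun p _ => (hI _ _ _ _).const_mul _, ?_⟩
    rw [integral_finsetSum _ fun p _ => (hI _ _ _ _).const_mul _]
    have hee : ∀ i j, inner ℝ (e i) (e j) = if i = j then (1 : ℝ) else 0 := fun i j => by
      simp [e, EuclideanSpace.inner_single_left]
    simp_rw [integral_const_mul, hval, hee, Fintype.sum_prod_type]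
    have hC' : ∀ i j, C j i = C i j := fun i j => by
      conv_rhs => rw [← hC]
      rfl
    simp only [mul_add, mul_ite, mul_one, mul_zero, Finset.sum_add_distrib, Finset.sum_ite_eq,
      Finset.mem_univ, if_true]
    simp only [Matrix.trace, diag, mul_apply]
    have h1 : ∀ x, (∑ y, ∑ z, if x = y then B x y * C z z * κ else 0) =
        κ * (B x x * ∑ z, C z z) := fun x => by
      rw [Finset.sum_comm]
      simp only [Finset.sum_ite_eq, Finset.mem_univ, if_true, Finset.mul_sum]
      exact Finset.sum_congr rfl fun _ _ => by ring
    have h2 : ∀ x y, (∑ z, ∑ t, if y = z then if x = t then B x y * C z t * κ else 0 else 0) =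
        κ * (B x y * C y x) := fun x y => by
      rw [Finset.sum_comm]
      simp only [Finset.sum_ite_eq, Finset.mem_univ, if_true]
      ring
    have h3 : ∀ x y, B x y * C x y * κ = κ * (B x y * C y x) := fun x y => by rw [hC' x y]; ring
    simp only [h1, h2, h3, ← Finset.mul_sum, ← Finset.sum_mul]
    ring
  refine ⟨(key B C hC).1, ?_⟩
  -- With both matrices equal to 1 the trace expression is `n ^ 2 + 2 n = n (n + 2)`, which fixes
  -- `κ`.
  have h1 := (key 1 1 (by simp)).2
  simp only [one_mulVec, trace_one, one_mul] at h1
  have hn : ∀ w : EuclideanSpace ℝ ι, w.ofLp ⬝ᵥ w.ofLp = ‖w‖ ^ 2 := fun w => by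
    rw [EuclideanSpace.real_norm_sq_eq]
    simp only [dotProduct, pow_two]
  have hn4 : ∀ w : EuclideanSpace ℝ ι, ‖w‖ ^ 2 * ‖w‖ ^ 2 = ‖w‖ ^ 4 := fun w => by ring
  simp only [hn, hn4] at h1
  rw [h1, (key B C hC).2]
  ring

end EuclideanMoments

/-! ### The spherical law and the modular variate -/

section Radial

open Set Filter Topology

/-- The spherical distribution on `ℝ^(2M)` with density generator `g`. -/
def sphericalLaw (M : ℕ) (g : ℝ → ℝ) : Measure (EuclideanSpace ℝ (Fin M ⊕ Fin M)) :=
  volume.withDensity fun w => ENNReal.ofReal (normConst M g * g (‖w‖ ^ 2))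

/-- A function on `ℝ` whose restriction to `(0, ∞)` is measurable. -/
def MeasurableOnPos (f : ℝ → ℝ) : Prop :=
  ∃ f' : ℝ → ℝ, Measurable f' ∧ EqOn f f' (Ioi 0)

lemma MeasurableOnPos.aemeasurable_restrict {f : ℝ → ℝ} (hf : MeasurableOnPos f) :
    AEMeasurable f (volume.restrict (Ioi 0)) := by
  obtain ⟨f', hm, he⟩ := hf
  exact ⟨f', hm, (ae_restrict_iff' measurableSet_Ioi).2 (.of_forall he)⟩

/-- Only the origin is sent outside `(0, ∞)`, and it is a null set; the uncontrolled values of `f`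
elsewhere do no harm. -/
lemma MeasurableOnPos.aemeasurable_comp_norm_sq {f : ℝ → ℝ} (hf : MeasurableOnPos f)
    {F : Type*} [NormedAddCommGroup F] [MeasurableSpace F] [BorelSpace F]
    {μ : Measure F} [NullSingletonClass μ] : AEMeasurable (fun w : F => f (‖w‖ ^ 2)) μ := by
  obtain ⟨f', hm, he⟩ := hf
  refine ⟨fun w => f' (‖w‖ ^ 2), hm.comp (by fun_prop), ?_⟩
  filter_upwards [compl_mem_ae_iff.2 (measure_singleton (0 : F))] with w hw
  exact he (show 0 < ‖w‖ ^ 2 by have := norm_pos_iff.2 hw; positivity)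

variable {M : ℕ} {g : ℝ → ℝ}

lemma IsDensityGenerator.measurableOnPos (hg : IsDensityGenerator M g) : MeasurableOnPos g := by
  classical
  refine ⟨(Ioi 0).piecewise g 0, hg.differentiable.continuousOn.measurable_piecewise
    continuousOn_const measurableSet_Ioi, fun t ht => ?_⟩
  rw [piecewise_eq_of_mem _ _ _ ht]

lemma IsDensityGenerator.measurableOnPos_phi (hg : IsDensityGenerator M g) :
    MeasurableOnPos (phi g) := by
  obtain ⟨g', hm, he⟩ := hg.measurableOnPos
  exact ⟨fun t => deriv g t / g' t, (measurable_deriv g).div hm, fun t ht => by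
    simp only [phi, he ht]⟩

lemma IsDensityGenerator.normConst_pos (hg : IsDensityGenerator M g) (hM : 0 < M) :
    0 < normConst M g := by
  have := hg.delta_pos
  have : 0 < Real.Gamma M := Real.Gamma_pos_of_pos (by exact_mod_cast hM)
  have := Real.pi_pos
  unfold normConst sphereArea
  positivity

lemma integral_modularLaw (hg : IsDensityGenerator M g) (f : ℝ → ℝ) :
    ∫ t, f t ∂modularLaw M g = (delta M g)⁻¹ * ∫ t in Ioi 0, t ^ (M - 1) * g t * f t := by
  have hm := hg.measurableOnPos.aemeasurable_restrict
  rw [modularLaw, integral_withDensity_eq_integral_toReal_smul₀ (by fun_prop) (by simp),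
    ← integral_const_mul]
  refine setIntegral_congr_fun measurableSet_Ioi fun t (ht : 0 < t) => ?_
  have := hg.nonneg t ht
  have := hg.delta_pos
  simp only [smul_eq_mul]
  rw [ENNReal.toReal_ofReal (by positivity)]
  ring

lemma integrable_modularLaw_iff (hg : IsDensityGenerator M g) (f : ℝ → ℝ) :
    Integrable f (modularLaw M g) ↔ IntegrableOn (fun t => t ^ (M - 1) * g t * f t) (Ioi 0) := by
  have hm := hg.measurableOnPos.aemeasurable_restrict
  have hd := hg.delta_pos
  rw [modularLaw, integrable_withDensity_iff_integrable_smul₀' (by fun_prop) (by simp),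
    IntegrableOn,
    ← integrable_const_mul_iff (IsUnit.mk0 _ (inv_ne_zero hd.ne'))
      (fun t => t ^ (M - 1) * g t * f t)]
  refine integrable_congr ((ae_restrict_iff' measurableSet_Ioi).2 (.of_forall
    fun t (ht : 0 < t) => ?_))
  have := hg.nonneg t ht
  simp only [smul_eq_mul]
  rw [ENNReal.toReal_ofReal (by positivity)]
  ring

lemma aemeasurable_sphericalLaw_density (hM : 0 < M) (hg : IsDensityGenerator M g) :
    AEMeasurable (fun w : EuclideanSpace ℝ (Fin M ⊕ Fin M) =>
      ENNReal.ofReal (normConst M g * g (‖w‖ ^ 2))) volume := by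
  have : Nonempty (Fin M) := ⟨⟨0, hM⟩⟩
  have := hg.measurableOnPos.aemeasurable_comp_norm_sq
    (μ := (volume : Measure (EuclideanSpace ℝ (Fin M ⊕ Fin M))))
  exact (this.const_mul _).ennreal_ofReal

lemma ae_ne_zero (hM : 0 < M) :
    ∀ᵐ w : EuclideanSpace ℝ (Fin M ⊕ Fin M), w ≠ 0 := by
  have : Nonempty (Fin M) := ⟨⟨0, hM⟩⟩
  exact compl_mem_ae_iff.2 (measure_singleton _)

lemma toReal_ofReal_density_ae (hM : 0 < M) (hg : IsDensityGenerator M g)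
    (f : EuclideanSpace ℝ (Fin M ⊕ Fin M) → ℝ) :
    (fun w => (ENNReal.ofReal (normConst M g * g (‖w‖ ^ 2))).toReal • f w) =ᵐ[volume]
      fun w => normConst M g * g (‖w‖ ^ 2) * f w := by
  filter_upwards [ae_ne_zero hM] with w hw
  have := hg.normConst_pos hM
  have := hg.nonneg (‖w‖ ^ 2) (by have := norm_pos_iff.2 hw; positivity)
  rw [ENNReal.toReal_ofReal (by positivity), smul_eq_mul]

lemma volume_ball_euclideanSpace_sum (M : ℕ) (hM : 0 < M) :
    (volume : Measure (EuclideanSpace ℝ (Fin M ⊕ Fin M))).real (Metric.ball 0 1) =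
      Real.pi ^ M / M.factorial := by
  have : Nonempty (Fin M) := ⟨⟨0, hM⟩⟩
  have : Nontrivial (EuclideanSpace ℝ (Fin M ⊕ Fin M)) := inferInstance
  rw [Measure.real, InnerProductSpace.volume_ball_of_dim_even (k := M) (by simp; ring)]
  simp only [ENNReal.ofReal_one, one_pow, one_mul]
  rw [ENNReal.toReal_ofReal (by positivity)]

lemma rpow_two_sub_one (x : ℝ) : x ^ ((2 : ℝ) - 1) = x := by norm_num

/-- The integrand identity for the substitution `t = r ^ 2`, written with the real exponent 2 so
that it fits the change of variables for `rpow`. -/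
lemma radial_substitution (hM : 0 < M) {f : ℝ → ℝ} {r : ℝ} :
    r ^ (2 * M - 1) * (g (r ^ 2) * f (r ^ 2)) =
      (1 / 2) * ((2 * r ^ ((2 : ℝ) - 1)) *
        ((r ^ (2 : ℝ)) ^ (M - 1) * g (r ^ (2 : ℝ)) * f (r ^ (2 : ℝ)))) := by
  obtain ⟨n, rfl⟩ : ∃ n, M = n + 1 := ⟨M - 1, by omega⟩
  rw [rpow_two_sub_one, Real.rpow_two, show 2 * (n + 1) - 1 = 2 * n + 1 by omega,
    Nat.add_sub_cancel, ← pow_mul]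
  ring

/-- Polar coordinates followed by `t = r ^ 2`. The dimension times the ball volume, `2 M π^M / M!`,
is the sphere area in `normConst`, so only `δ⁻¹` survives. -/
lemma integral_sphericalLaw (hM : 0 < M) (hg : IsDensityGenerator M g) (f : ℝ → ℝ) :
    ∫ w, f (‖w‖ ^ 2) ∂sphericalLaw M g = ∫ t, f t ∂modularLaw M g := by
  have : Nonempty (Fin M) := ⟨⟨0, hM⟩⟩
  have hd : Module.finrank ℝ (EuclideanSpace ℝ (Fin M ⊕ Fin M)) = 2 * M := by simp; ring
  rw [integral_modularLaw hg, sphericalLaw, integral_withDensity_eq_integral_toReal_smul₀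
    (aemeasurable_sphericalLaw_density hM hg) (by simp),
    integral_congr_ae (toReal_ofReal_density_ae hM hg _)]
  simp only [mul_assoc (normConst M g)]
  rw [integral_const_mul, integral_fun_norm_addHaar volume (fun r => g (r ^ 2) * f (r ^ 2)), hd,
    volume_ball_euclideanSpace_sum M hM]
  simp only [smul_eq_mul, nsmul_eq_mul]
  rw [← integral_comp_rpow_Ioi_of_pos (g := fun t => t ^ (M - 1) * g t * f t) two_pos]
  simp only [smul_eq_mul]
  simp_rw [radial_substitution hM, integral_const_mul]
  have hδ := hg.delta_pos.ne'
  have hπ := Real.pi_ne_zero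
  obtain ⟨n, rfl⟩ : ∃ n, M = n + 1 := ⟨M - 1, by omega⟩
  rw [normConst, sphereArea, Nat.factorial_succ]
  push_cast
  rw [Real.Gamma_nat_eq_factorial]
  have : (n.factorial : ℝ) ≠ 0 := by positivity
  have : (n : ℝ) + 1 ≠ 0 := by positivity
  field_simp

lemma integrable_sphericalLaw_iff (hM : 0 < M) (hg : IsDensityGenerator M g) (f : ℝ → ℝ) :
    Integrable (fun w => f (‖w‖ ^ 2)) (sphericalLaw M g) ↔ Integrable f (modularLaw M g) := by
  have : Nonempty (Fin M) := ⟨⟨0, hM⟩⟩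
  have hd : Module.finrank ℝ (EuclideanSpace ℝ (Fin M ⊕ Fin M)) = 2 * M := by simp; ring
  have hc := hg.normConst_pos hM
  rw [integrable_modularLaw_iff hg, sphericalLaw, integrable_withDensity_iff_integrable_smul₀'
    (aemeasurable_sphericalLaw_density hM hg) (by simp),
    integrable_congr (toReal_ofReal_density_ae hM hg _)]
  simp only [mul_assoc (normConst M g)]
  rw [integrable_const_mul_iff (IsUnit.mk0 _ hc.ne'),
    integrable_fun_norm_addHaar volume (f := fun r => g (r ^ 2) * f (r ^ 2)), hd,
    ← integrableOn_Ioi_comp_rpow_iff (fun t => t ^ (M - 1) * g t * f t) two_ne_zero]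
  simp only [smul_eq_mul, abs_two]
  simp_rw [radial_substitution hM, IntegrableOn]
  rw [integrable_const_mul_iff (IsUnit.mk0 _ (by norm_num))]

lemma integral_modularLaw_one (hg : IsDensityGenerator M g) :
    ∫ _, (1 : ℝ) ∂modularLaw M g = 1 := by
  rw [integral_modularLaw hg]
  simp only [mul_one]
  exact inv_mul_cancel₀ hg.delta_pos.ne'

lemma isProbabilityMeasure_sphericalLaw (hM : 0 < M) (hg : IsDensityGenerator M g) :
    IsProbabilityMeasure (sphericalLaw M g) := by
  have h := integral_sphericalLaw hM hg (fun _ => 1)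
  rw [integral_modularLaw_one hg, integral_const, smul_eq_mul, mul_one] at h
  constructor
  rwa [Measure.real, ENNReal.toReal_eq_one_iff] at h

lemma isRotationInvariant_sphericalLaw : IsRotationInvariant (sphericalLaw M g) := by
  intro e
  refine ⟨e.continuous.measurable, ?_⟩
  ext s hs
  have he : MeasurableSet (e ⁻¹' s) := e.continuous.measurable hs
  rw [Measure.map_apply e.continuous.measurable hs, sphericalLaw, withDensity_apply _ he,
    withDensity_apply _ hs, ← (e.measurePreserving).setLIntegral_comp_preimage_emb
      e.toHomeomorph.measurableEmbedding _ s]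
  simp

/-- A law gives no mass to the zeros of its own density. This excludes the points where the
log-likelihood takes the default value of `Real.log 0`. -/
lemma sphericalLaw_ae_pos (hM : 0 < M) (hg : IsDensityGenerator M g) :
    ∀ᵐ w ∂sphericalLaw M g, w ≠ 0 ∧ 0 < g (‖w‖ ^ 2) := by
  have h1 : ∀ᵐ w ∂sphericalLaw M g, w ≠ 0 :=
    (withDensity_absolutelyContinuous _ _).ae_le (ae_ne_zero hM)
  have h2 : ∀ᵐ w ∂sphericalLaw M g, ENNReal.ofReal (normConst M g * g (‖w‖ ^ 2)) ≠ 0 := by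
    rw [sphericalLaw, ae_withDensity_iff' (aemeasurable_sphericalLaw_density hM hg)]
    exact .of_forall fun _ h => h
  filter_upwards [h1, h2] with w hw h
  refine ⟨hw, ?_⟩
  rw [ne_eq, ENNReal.ofReal_eq_zero, not_le] at h
  exact pos_of_mul_pos_right h (hg.normConst_pos hM).le

lemma aestronglyMeasurable_sphericalLaw (hM : 0 < M) {f : ℝ → ℝ} (hf : MeasurableOnPos f) :
    AEStronglyMeasurable (fun w => f (‖w‖ ^ 2)) (sphericalLaw M g) := by
  have : Nonempty (Fin M) := ⟨⟨0, hM⟩⟩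
  exact ((hf.aemeasurable_comp_norm_sq (μ := volume)).mono_ac
    (withDensity_absolutelyContinuous _ _)).aestronglyMeasurable

/-- A zero of the nonnegative `g` is a local minimum, so `g'` vanishes there too. The default value
of `φ` at such a point therefore loses nothing. -/
lemma IsDensityGenerator.g_mul_phi (hg : IsDensityGenerator M g) {t : ℝ} (ht : 0 < t) :
    g t * phi g t = deriv g t := by
  rcases (hg.nonneg t ht).eq_or_lt with h0 | h0
  · have hmin : IsLocalMin g t := by
      filter_upwards [Ioi_mem_nhds ht] with s hs
      rw [← h0]
      exact hg.nonneg s hs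
    rw [hmin.deriv_eq_zero, ← h0, zero_mul]
  · rw [phi]
    field_simp

/-- Moves integrals to the whole line, where an integrable function with integrable derivative has
derivative of integral zero. -/
lemma integral_Ioi_eq_integral_comp_exp (f : ℝ → ℝ) :
    ∫ t in Ioi (0 : ℝ), f t = ∫ s, Real.exp s * f (Real.exp s) := by
  have h := integral_image_eq_integral_abs_deriv_smul MeasurableSet.univ
    (fun x _ => (Real.hasDerivAt_exp x).hasDerivWithinAt) Real.exp_injective.injOn f
  simpa only [image_univ, Real.range_exp, Real.abs_exp, smul_eq_mul, setIntegral_univ] using h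

lemma integrableOn_Ioi_iff_integrable_comp_exp (f : ℝ → ℝ) :
    IntegrableOn f (Ioi 0) ↔ Integrable fun s => Real.exp s * f (Real.exp s) := by
  have h := integrableOn_image_iff_integrableOn_abs_deriv_smul MeasurableSet.univ
    (fun x _ => (Real.hasDerivAt_exp x).hasDerivWithinAt) Real.exp_injective.injOn f
  simpa only [image_univ, Real.range_exp, Real.abs_exp, smul_eq_mul, integrableOn_univ] using h

/-- If `Q² φ(Q)²` is integrable then so is `Q φ(Q)`. -/
lemma integrable_mul_phi (hg : IsDensityGenerator M g)
    (hQ2 : Integrable (fun t : ℝ => t ^ 2 * phi g t ^ 2) (modularLaw M g)) :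
    Integrable (fun t : ℝ => t * phi g t) (modularLaw M g) := by
  have h1 : Integrable (fun _ : ℝ => (1 : ℝ)) (modularLaw M g) := by
    -- A nonintegrable function would have integral 0 by convention, but this integral is 1.
    by_contra h
    have := integral_undef h
    rw [integral_modularLaw_one hg] at this
    norm_num at this
  have hac : modularLaw M g ≪ volume.restrict (Ioi 0) := withDensity_absolutelyContinuous _ _
  refine (h1.add hQ2).mono' ((measurable_id.aemeasurable.mul
    (hg.measurableOnPos_phi.aemeasurable_restrict.mono_ac hac)).aestronglyMeasurable)
    (.of_forall fun t => ?_)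
  simp only [Pi.add_apply, Real.norm_eq_abs]
  rw [← mul_pow, ← sq_abs (t * phi g t)]
  nlinarith [sq_nonneg (|t * phi g t| - 1), sq_nonneg (|t * phi g t|)]

/-- `E[Q φ(Q)] = -M`, by partial integration. -/
lemma integral_mul_phi (hM : 0 < M) (hg : IsDensityGenerator M g)
    (hQ2 : Integrable (fun t : ℝ => t ^ 2 * phi g t ^ 2) (modularLaw M g)) :
    ∫ t, t * phi g t ∂modularLaw M g = -M := by
  have hint := (integrable_modularLaw_iff hg _).1 (integrable_mul_phi hg hQ2)
  have hpow : ∀ t : ℝ, t ^ (M - 1) * t = t ^ M := fun t => pow_sub_one_mul hM.ne' t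
  have hcongr : EqOn (fun t => t ^ (M - 1) * g t * (t * phi g t)) (fun t => t ^ M * deriv g t)
      (Ioi 0) := fun t ht => by
    simp only [← hg.g_mul_phi ht, ← hpow]
    ring
  rw [integral_modularLaw hg, setIntegral_congr_fun measurableSet_Ioi hcongr]
  have hint' : IntegrableOn (fun t => t ^ M * deriv g t) (Ioi 0) :=
    hint.congr_fun hcongr measurableSet_Ioi
  have hderiv : ∀ t ∈ Ioi (0 : ℝ), HasDerivAt (fun t => t ^ M * g t)
      (M * (t ^ (M - 1) * g t) + t ^ M * deriv g t) t := fun t ht => by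
    simpa only [mul_assoc] using (hasDerivAt_pow M t).fun_mul
      (hg.differentiable.differentiableAt (Ioi_mem_nhds ht)).hasDerivAt
  have hF' : IntegrableOn (fun t => M * (t ^ (M - 1) * g t) + t ^ M * deriv g t) (Ioi 0) :=
    (hg.integrable.const_mul _).add hint'
  have hzero : ∫ t in Ioi (0 : ℝ), (M * (t ^ (M - 1) * g t) + t ^ M * deriv g t) = 0 := by
    rw [integral_Ioi_eq_integral_comp_exp]
    -- After `t = exp s`, the function `t ^ M * g t` is itself integrable because it is `exp s`
    -- times `t ^ (M - 1) * g t`. Hence no boundary limits of `t ^ M * g t` have to be computed.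
    refine integral_eq_zero_of_hasDerivAt_of_integrable
      (f := fun s => Real.exp s ^ M * g (Real.exp s))
      (fun s => ?_) ((integrableOn_Ioi_iff_integrable_comp_exp _).1 hF') ?_
    · convert! (hderiv _ (Real.exp_pos s)).comp s (Real.hasDerivAt_exp s) using 1
      ring
    · refine ((integrableOn_Ioi_iff_integrable_comp_exp _).1 hg.integrable).congr
        (.of_forall fun s => ?_)
      simp only [← hpow (Real.exp s)]
      ring
  rw [integral_add (hg.integrable.const_mul _) hint', integral_const_mul] at hzero
  have hδ := hg.delta_pos.ne'
  rw [show ∫ t in Ioi (0 : ℝ), t ^ M * deriv g t = -(M * delta M g) by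
    rw [delta]; linarith]
  field_simp

end Radial

/-! ### Conjugation symmetry and the real square root -/

section AugmentedAlgebra

variable {M : ℕ}

/-- The matrix that maps `(Re z, Im z)` to the augmented vector of `z`. -/
def realToAug (M : ℕ) : Matrix (Fin M ⊕ Fin M) (Fin M ⊕ Fin M) ℂ :=
  fromBlocks 1 (Complex.I • 1) 1 (-Complex.I • 1)

lemma realToAug_mul_conjTranspose : realToAug M * (realToAug M)ᴴ = (2 : ℂ) • 1 := by
  rw [realToAug, fromBlocks_conjTranspose, fromBlocks_multiply, ← fromBlocks_one, fromBlocks_smul]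
  simp [smul_smul, ← two_smul ℂ]

lemma realToAug_map_star :
    (realToAug M).map star = (realToAug M).submatrix (Equiv.sumComm _ _) (Equiv.refl _) := by
  ext i j
  rcases i with i | i <;> rcases j with j | j <;>
    simp [realToAug, one_apply] <;> split_ifs <;> simp

lemma map_star_mul {n : Type*} [Fintype n] (A B : Matrix n n ℂ) :
    (A * B).map star = A.map star * B.map star :=
  Matrix.map_mul (f := starRingEnd ℂ)

lemma conjTranspose_map_star {n : Type*} (A : Matrix n n ℂ) : Aᴴ.map star = (A.map star)ᴴ := rfl

lemma augScatter_map_star (S W : Matrix (Fin M) (Fin M) ℂ) :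
    (augScatter S W).map star =
      (augScatter S W).submatrix (Equiv.sumComm _ _) (Equiv.sumComm _ _) := by
  ext i j
  rcases i with i | i <;> rcases j with j | j <;> simp [augScatter]

-- Conjugating the positive square root and swapping its blocks gives a positive semidefinite square
-- root of the same `A`. Uniqueness forces the two to agree.
open scoped MatrixOrder in
lemma sqrt_map_star {A : Matrix (Fin M ⊕ Fin M) (Fin M ⊕ Fin M) ℂ} (hA : A.PosSemidef)
    (h : A.map star = A.submatrix (Equiv.sumComm _ _) (Equiv.sumComm _ _)) :
    (CFC.sqrt A).map star = (CFC.sqrt A).submatrix (Equiv.sumComm _ _) (Equiv.sumComm _ _) := by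
  set P := CFC.sqrt A
  have hP : P.PosSemidef := (CFC.sqrt_nonneg A).posSemidef
  have hPP : P * P = A := CFC.sqrt_mul_sqrt_self A hA.nonneg
  have ht : P.map star = Pᵀ := by
    conv_rhs => rw [← hP.1, conjTranspose, transpose_map, transpose_transpose]
  have h1 : ((P.map star).submatrix (Equiv.sumComm _ _) (Equiv.sumComm _ _)).PosSemidef := by
    rw [ht]
    exact hP.transpose.submatrix _
  have h2 : (P.map star).submatrix (Equiv.sumComm _ _) (Equiv.sumComm _ _) *
      (P.map star).submatrix (Equiv.sumComm _ _) (Equiv.sumComm _ _) = A := by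
    rw [submatrix_mul_equiv, ← map_star_mul, hPP, h, submatrix_submatrix]
    ext i j
    simp
  have h3 : P = _ := CFC.sqrt_unique h2 h1.nonneg
  conv_rhs => rw [h3, submatrix_submatrix]
  ext i j
  simp

open scoped MatrixOrder in
/-- A real square root of the extended scatter matrix in real coordinates. -/
lemma exists_whitening {S W : Matrix (Fin M) (Fin M) ℂ} (h : (augScatter S W).PosDef) :
    ∃ R : Matrix (Fin M ⊕ Fin M) (Fin M ⊕ Fin M) ℝ,
      R.det ^ 2 = (augScatter S W).det.re ∧
      (realToAug M * R.map Complex.ofReal) * (realToAug M * R.map Complex.ofReal)ᴴ =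
        (2 : ℂ) • augScatter S W := by
  set P := CFC.sqrt (augScatter S W)
  have hP : Pᴴ = P := (CFC.sqrt_nonneg (augScatter S W)).posSemidef.1
  have hPP : P * P = augScatter S W := CFC.sqrt_mul_sqrt_self _ h.posSemidef.nonneg
  have hPs := sqrt_map_star h.posSemidef (augScatter_map_star S W)
  set T := realToAug M
  -- This is `T⁻¹ * P * T`, as `T⁻¹ = Tᴴ / 2`: the root `P` read in real coordinates. The block
  -- swaps coming from `Tᴴ`, `P` and `T` cancel under conjugation, so it is real.
  set R' := (1 / 2 : ℂ) • (Tᴴ * P * T)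
  have hTs : Tᴴ.map star = Tᴴ.submatrix (Equiv.refl _) (Equiv.sumComm _ _) := by
    rw [conjTranspose_map_star, realToAug_map_star]
    rfl
  have hR' : R'.map star = R' := by
    have : R'.map star = (1 / 2 : ℂ) • (Tᴴ * P * T).map star := by
      ext i j
      have h2 : star (1 / 2 : ℂ) = 1 / 2 := by simp
      simp only [R', map_apply, Matrix.smul_apply, smul_eq_mul, star_mul', h2]
    rw [this, map_star_mul, map_star_mul, hTs, hPs, realToAug_map_star, submatrix_mul_equiv,
      submatrix_mul_equiv]
    rfl
  set R : Matrix (Fin M ⊕ Fin M) (Fin M ⊕ Fin M) ℝ := R'.map Complex.re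
  have hR : R.map Complex.ofReal = R' := by
    ext i j
    have := congrFun (congrFun hR' i) j
    exact Complex.conj_eq_iff_re.1 this
  have hTR : T * R' = P * T := by
    simp only [R', Matrix.mul_smul, ← Matrix.mul_assoc, T, realToAug_mul_conjTranspose]
    simp [smul_smul]
  refine ⟨R, ?_, ?_⟩
  · have h1 : (R.det : ℂ) = R'.det := by
      rw [← hR]
      exact Complex.ofRealHom.map_det R
    have hT : T.det ≠ 0 := by
      intro h0
      have := congrArg det (realToAug_mul_conjTranspose (M := M))
      rw [det_mul, h0, zero_mul, det_smul, det_one] at this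
      simp only [mul_one] at this
      exact pow_ne_zero _ two_ne_zero this.symm
    have h2 : R'.det = P.det := by
      have := congrArg det hTR
      rw [det_mul, det_mul, mul_comm] at this
      exact mul_right_cancel₀ hT this
    have h3 : ((R.det ^ 2 : ℝ) : ℂ) = (augScatter S W).det := by
      rw [← hPP, det_mul]
      push_cast
      rw [h1, h2, pow_two]
    rw [← h3, Complex.ofReal_re]
  · rw [hR, hTR, conjTranspose_mul, hP, Matrix.mul_assoc, ← Matrix.mul_assoc T,
      realToAug_mul_conjTranspose]
    simp [hPP]

/-- Properties of an invertible square root `C` of `2 G` that conjugates like the matrix that maps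
real coordinates to augmented vectors. -/
structure IsWhitening (C G : Matrix (Fin M ⊕ Fin M) (Fin M ⊕ Fin M) ℂ) : Prop where
  isUnit_det : IsUnit C.det
  mul_conjTranspose : C * Cᴴ = (2 : ℂ) • G
  map_star : C.map star = C.submatrix (Equiv.sumComm _ _) (Equiv.refl _)

namespace IsWhitening

variable {C G : Matrix (Fin M ⊕ Fin M) (Fin M ⊕ Fin M) ℂ} (hC : IsWhitening C G)
include hC

lemma inv_eq : G⁻¹ = (2 : ℂ) • (C⁻¹ᴴ * C⁻¹) := by
  have hG : G = (1 / 2 : ℂ) • (C * Cᴴ) := by rw [hC.mul_conjTranspose]; simp [smul_smul]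
  have hC' := hC.isUnit_det
  refine inv_eq_right_inv ?_
  rw [hG, Matrix.smul_mul, Matrix.mul_smul, smul_smul, Matrix.mul_assoc, ← Matrix.mul_assoc Cᴴ,
    ← conjTranspose_mul, nonsing_inv_mul _ hC', conjTranspose_one, Matrix.one_mul,
    mul_nonsing_inv _ hC']
  simp

lemma inv_map_star : C⁻¹.map star = C⁻¹.submatrix (Equiv.refl _) (Equiv.sumComm _ _) := by
  rw [← inv_submatrix_equiv, ← hC.map_star]
  refine (inv_eq_left_inv ?_).symm
  rw [← map_star_mul, nonsing_inv_mul _ hC.isUnit_det]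
  ext i j
  simp [one_apply, apply_ite]

lemma conjTranspose_inv_map_star :
    C⁻¹ᴴ.map star = C⁻¹ᴴ.submatrix (Equiv.sumComm _ _) (Equiv.refl _) := by
  rw [conjTranspose_map_star, hC.inv_map_star]
  rfl

/-- The whitened coordinates of an augmented vector are real. -/
lemma star_inv_mulVec {v : Fin M ⊕ Fin M → ℂ} (hv : star v = v ∘ Sum.swap) :
    star (C⁻¹ *ᵥ v) = C⁻¹ *ᵥ v := by
  have h1 : star (C⁻¹ *ᵥ v) = C⁻¹.map star *ᵥ star v := by
    ext i
    simp [mulVec, dotProduct]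
  rw [h1, hC.inv_map_star, hv]
  exact submatrix_mulVec_equiv C⁻¹ (v ∘ Sum.swap) (Equiv.refl _) (Equiv.sumComm _ _) |>.trans (by
    simp [Function.comp_def])

/-- Whitening an augmented matrix gives a real matrix. -/
lemma whiten_map_star {A : Matrix (Fin M ⊕ Fin M) (Fin M ⊕ Fin M) ℂ}
    (hA : A.map star = A.submatrix (Equiv.sumComm _ _) (Equiv.sumComm _ _)) :
    (C⁻¹ * A * C⁻¹ᴴ).map star = C⁻¹ * A * C⁻¹ᴴ := by
  rw [map_star_mul, map_star_mul, hC.inv_map_star, hA, hC.conjTranspose_inv_map_star,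
    submatrix_mul_equiv, submatrix_mul_equiv]
  rfl

lemma trace_whiten (A : Matrix (Fin M ⊕ Fin M) (Fin M ⊕ Fin M) ℂ) :
    2 * (C⁻¹ * A * C⁻¹ᴴ).trace = (A * G⁻¹).trace := by
  rw [hC.inv_eq, Matrix.mul_smul, trace_smul, smul_eq_mul, Matrix.mul_assoc, trace_mul_comm,
    Matrix.mul_assoc]

lemma trace_whiten_mul (A B : Matrix (Fin M ⊕ Fin M) (Fin M ⊕ Fin M) ℂ) :
    4 * ((C⁻¹ * A * C⁻¹ᴴ) * (C⁻¹ * B * C⁻¹ᴴ)).trace = (A * G⁻¹ * B * G⁻¹).trace := by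
  rw [hC.inv_eq]
  simp only [Matrix.mul_smul, Matrix.smul_mul, trace_smul, smul_eq_mul, smul_smul]
  rw [Matrix.mul_assoc C⁻¹ A, Matrix.mul_assoc C⁻¹, trace_mul_comm C⁻¹]
  simp only [Matrix.mul_assoc]
  norm_num

end IsWhitening

end AugmentedAlgebra

/-! ### Derivatives of inverses, determinants and quadratic forms -/

section Calculus

variable {ι : Type*} [Fintype ι] [DecidableEq ι]

omit [DecidableEq ι] in
lemma hasDerivAt_mulVec_apply {A : ℝ → Matrix ι ι ℂ} {A' : Matrix ι ι ℂ} {u : ℝ → ι → ℂ}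
    {u' : ι → ℂ} {t : ℝ} (hA : ∀ i j, HasDerivAt (fun s => A s i j) (A' i j) t)
    (hu : ∀ i, HasDerivAt (fun s => u s i) (u' i) t) (i : ι) :
    HasDerivAt (fun s => (A s *ᵥ u s) i) ((A' *ᵥ u t) i + (A t *ᵥ u') i) t := by
  simp only [mulVec, dotProduct, ← Finset.sum_add_distrib]
  exact HasDerivAt.fun_sum fun j _ => (hA i j).fun_mul (hu j)

omit [DecidableEq ι] in
lemma hasDerivAt_dotProduct {v u : ℝ → ι → ℂ} {v' u' : ι → ℂ} {t : ℝ}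
    (hv : ∀ i, HasDerivAt (fun s => v s i) (v' i) t)
    (hu : ∀ i, HasDerivAt (fun s => u s i) (u' i) t) :
    HasDerivAt (fun s => v s ⬝ᵥ u s) (v' ⬝ᵥ u t + v t ⬝ᵥ u') t := by
  simp only [dotProduct, ← Finset.sum_add_distrib]
  exact HasDerivAt.fun_sum fun j _ => (hv j).fun_mul (hu j)

open scoped Matrix.Norms.Operator in
lemma hasDerivAt_inv_apply {G : ℝ → Matrix ι ι ℂ} {G' : Matrix ι ι ℂ} {t : ℝ}
    (hG : ∀ i j, HasDerivAt (fun s => G s i j) (G' i j) t) (hdet : IsUnit (G t).det) (i j : ι) :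
    HasDerivAt (fun s => (G s)⁻¹ i j) ((-((G t)⁻¹ * G' * (G t)⁻¹)) i j) t := by
  have h1 : HasDerivAt G G' t := hasDerivAt_pi.2 fun i => hasDerivAt_pi.2 fun j => hG i j
  obtain ⟨U, hU⟩ := (isUnit_iff_isUnit_det (G t)).2 hdet
  have h2 := hasFDerivAt_ringInverse (𝕜 := ℝ) U
  rw [hU] at h2
  have h3 := h2.comp_hasDerivAt t h1
  have h4 : (↑U⁻¹ : Matrix ι ι ℂ) = (G t)⁻¹ := by rw [← hU, coe_units_inv]
  simp only [h4] at h3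
  have h5 := hasDerivAt_pi.1 (hasDerivAt_pi.1 h3 i) j
  simpa [nonsing_inv_eq_ringInverse] using h5

/-- Jacobi's formula. Differentiating the Leibniz expansion in column `j` yields the determinant
with that column replaced by the one of `G'`, which Cramer's rule expresses through the adjugate. -/
lemma hasDerivAt_det {G : ℝ → Matrix ι ι ℂ} {G' : Matrix ι ι ℂ} {t : ℝ}
    (hG : ∀ i j, HasDerivAt (fun s => G s i j) (G' i j) t) (hdet : IsUnit (G t).det) :
    HasDerivAt (fun s => (G s).det) ((G t).det * ((G t)⁻¹ * G').trace) t := by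
  have h1 : HasDerivAt (fun s => (G s).det) (∑ σ : Equiv.Perm ι, ((Equiv.Perm.sign σ : ℤ) : ℂ) *
      ∑ j, (∏ i ∈ Finset.univ.erase j, G t (σ i) i) • G' (σ j) j) t := by
    simp only [det_apply']
    exact HasDerivAt.fun_sum fun σ _ => (HasDerivAt.fun_finsetProd fun i _ => hG _ _).const_mul _
  refine h1.congr_deriv ?_
  have h2 : ∀ j, (∑ σ : Equiv.Perm ι, ((Equiv.Perm.sign σ : ℤ) : ℂ) *
      ((∏ i ∈ Finset.univ.erase j, G t (σ i) i) • G' (σ j) j)) = ((G t).adjugate * G') j j := by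
    intro j
    have h3 : ((G t).adjugate * G') j j = (G t).cramer (fun i => G' i j) j := by
      rw [cramer_eq_adjugate_mulVec]
      rfl
    rw [h3, cramer_apply, det_apply']
    refine Finset.sum_congr rfl fun σ _ => ?_
    rw [← Finset.mul_prod_erase _ _ (Finset.mem_univ j), updateCol_self, smul_eq_mul,
      mul_comm (G' (σ j) j)]
    congr 2
    exact Finset.prod_congr rfl fun i hi => (updateCol_ne (Finset.ne_of_mem_erase hi)).symm
  have h4 : (G t).det * ((G t)⁻¹ * G').trace = ((G t).adjugate * G').trace := by
    rw [inv_def, Matrix.smul_mul, trace_smul, smul_eq_mul, ← mul_assoc,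
      Ring.mul_inverse_cancel _ hdet, one_mul]
  simp only [Finset.mul_sum]
  rw [Finset.sum_comm, h4]
  exact Finset.sum_congr rfl fun j _ => h2 j

lemma hasDerivAt_quadForm {G : ℝ → Matrix ι ι ℂ} {G' : Matrix ι ι ℂ} {u : ℝ → ι → ℂ}
    {u' : ι → ℂ} {t : ℝ} (hG : ∀ i j, HasDerivAt (fun s => G s i j) (G' i j) t)
    (hdet : IsUnit (G t).det) (hu : ∀ i, HasDerivAt (fun s => u s i) (u' i) t) :
    HasDerivAt (fun s => star (u s) ⬝ᵥ ((G s)⁻¹ *ᵥ u s))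
      (star u' ⬝ᵥ ((G t)⁻¹ *ᵥ u t) + star (u t) ⬝ᵥ ((G t)⁻¹ *ᵥ u') -
        star (u t) ⬝ᵥ (((G t)⁻¹ * G' * (G t)⁻¹) *ᵥ u t)) t := by
  have h := hasDerivAt_dotProduct (fun i => (hu i).star)
    (hasDerivAt_mulVec_apply (hasDerivAt_inv_apply hG hdet) hu)
  refine h.congr_deriv ?_
  change star u' ⬝ᵥ _ + star (u t) ⬝ᵥ ((-((G t)⁻¹ * G' * (G t)⁻¹)) *ᵥ u t + (G t)⁻¹ *ᵥ u') = _
  rw [dotProduct_add, neg_mulVec, dotProduct_neg]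
  ring

end Calculus

/-! ### Transport of the spherical law to `ℂ^M` -/

section ChangeOfVariables

variable {M : ℕ}

/-- Real coordinates `(Re z, Im z)` of vectors of `ℂ^M`. -/
def ofRealCoords (M : ℕ) : (Fin M ⊕ Fin M → ℝ) ≃ᵐ (Fin M → ℂ) :=
  ((MeasurableEquiv.sumPiEquivProdPi fun _ : Fin M ⊕ Fin M => ℝ).trans
    (MeasurableEquiv.arrowProdEquivProdArrow ℝ ℝ (Fin M)).symm).trans
    (MeasurableEquiv.piCongrRight fun _ => Complex.measurableEquivRealProd.symm)

lemma ofRealCoords_apply (x : Fin M ⊕ Fin M → ℝ) (i : Fin M) :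
    ofRealCoords M x i = x (Sum.inl i) + x (Sum.inr i) * Complex.I := by
  exact Complex.mk_eq_add_mul_I _ _

lemma measurePreserving_ofRealCoords : MeasurePreserving (ofRealCoords M) volume volume :=
  ((volume_measurePreserving_sumPiEquivProdPi fun _ : Fin M ⊕ Fin M => ℝ).trans
    (volume_measurePreserving_arrowProdEquivProdArrow ℝ ℝ (Fin M)).symm).trans
    (volume_preserving_pi fun _ => Complex.volume_preserving_equiv_real_prod.symm)

lemma aug_ofRealCoords (x : Fin M ⊕ Fin M → ℝ) :
    aug (ofRealCoords M x) = realToAug M *ᵥ (Complex.ofReal ∘ x) := by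
  ext i
  have h : ∀ y : Fin M → ℂ, (1 : Matrix (Fin M) (Fin M) ℂ) *ᵥ y = y := one_mulVec
  rw [realToAug, fromBlocks_mulVec]
  rcases i with i | i <;>
    simp [aug, ofRealCoords_apply, neg_mulVec, smul_mulVec, mul_comm]

/-- The affine change of variables `w ↦ m + R w` from real coordinates to `ℂ^M`. -/
def affineEquiv (m : Fin M → ℂ) (R : Matrix (Fin M ⊕ Fin M) (Fin M ⊕ Fin M) ℝ)
    (hR : R.det ≠ 0) : EuclideanSpace ℝ (Fin M ⊕ Fin M) ≃ᵐ (Fin M → ℂ) :=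
  (((MeasurableEquiv.toLp 2 (Fin M ⊕ Fin M → ℝ)).symm.trans
    (Matrix.toLinearEquiv' R ((isUnit_iff_isUnit_det R).2 hR.isUnit).invertible
      ).toContinuousLinearEquiv.toHomeomorph.toMeasurableEquiv).trans
    (ofRealCoords M)).trans (MeasurableEquiv.addLeft m)

lemma affineEquiv_apply (m : Fin M → ℂ) (R : Matrix (Fin M ⊕ Fin M) (Fin M ⊕ Fin M) ℝ)
    (hR : R.det ≠ 0) (w : EuclideanSpace ℝ (Fin M ⊕ Fin M)) :
    affineEquiv m R hR w = m + ofRealCoords M (R *ᵥ w) := rfl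

lemma map_affineEquiv_volume (m : Fin M → ℂ) (R : Matrix (Fin M ⊕ Fin M) (Fin M ⊕ Fin M) ℝ)
    (hR : R.det ≠ 0) :
    (volume : Measure (EuclideanSpace ℝ (Fin M ⊕ Fin M))).map (affineEquiv m R hR) =
      ENNReal.ofReal |R.det⁻¹| • volume := by
  have h : (affineEquiv m R hR : EuclideanSpace ℝ (Fin M ⊕ Fin M) → (Fin M → ℂ)) =
      (fun z => m + z) ∘ ofRealCoords M ∘ toLin' R ∘ @WithLp.ofLp 2 (Fin M ⊕ Fin M → ℝ) := rfl
  have hl : Measurable (toLin' R) := (LinearMap.continuous_of_finiteDimensional _).measurable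
  rw [h, ← Measure.map_map (by fun_prop) (by fun_prop),
    ← Measure.map_map (by fun_prop) (by fun_prop),
    ← Measure.map_map hl (by fun_prop), (PiLp.volume_preserving_ofLp _).map_eq,
    Real.map_matrix_volume_pi_eq_smul_volume_pi hR, Measure.map_smul,
    measurePreserving_ofRealCoords.map_eq, Measure.map_smul, map_add_left_eq_self]

lemma map_withDensity_comp {α β : Type*} [MeasurableSpace α] [MeasurableSpace β] (e : α ≃ᵐ β)
    (μ : Measure α) (h : β → ENNReal) :
    (μ.withDensity (h ∘ e)).map e = (μ.map e).withDensity h := by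
  ext s hs
  rw [Measure.map_apply e.measurable hs, withDensity_apply _ (e.measurable hs),
    withDensity_apply _ hs, Measure.restrict_map e.measurable hs, lintegral_map_equiv]
  rfl

/-- The NC-CES distribution is an affine image of the spherical distribution. -/
lemma law_eq_map (g : ℝ → ℝ) (m : Fin M → ℂ)
    (S W : Matrix (Fin M) (Fin M) ℂ) (R : Matrix (Fin M ⊕ Fin M) (Fin M ⊕ Fin M) ℝ)
    (hR : R.det ≠ 0) (hdet : R.det ^ 2 = (augScatter S W).det.re)
    (heta : ∀ w, eta m S W (affineEquiv m R hR w) = ‖w‖ ^ 2) :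
    law g m S W = (sphericalLaw M g).map (affineEquiv m R hR) := by
  -- The factor `|G|^(-1/2)` is exactly the Jacobian of the affine map.
  have h1 : (augScatter S W).det.re ^ (-(1 / 2) : ℝ) = |R.det⁻¹| := by
    rw [← hdet, abs_inv, ← sq_abs, ← Real.rpow_natCast, ← Real.rpow_mul (abs_nonneg _)]
    norm_num
    rw [Real.rpow_neg_one]
  have h2 : sphericalLaw M g = volume.withDensity
      ((fun z => ENNReal.ofReal (normConst M g * g (eta m S W z))) ∘ affineEquiv m R hR) := by
    simp only [sphericalLaw, Function.comp_def, heta]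
  rw [h2, map_withDensity_comp, map_affineEquiv_volume, withDensity_smul_measure,
    ← withDensity_smul' _ _ ENNReal.ofReal_ne_top, law]
  congr 1
  funext z
  rw [density, h1, Pi.smul_apply, smul_eq_mul, ← ENNReal.ofReal_mul (abs_nonneg _)]
  congr 1
  ring

end ChangeOfVariables

/-! ### Moments of the whitened score -/

section SphericalScore

variable {M : ℕ} {g : ℝ → ℝ}

/-- The score in whitened coordinates. -/
def whitenedScore (g : ℝ → ℝ) (β : EuclideanSpace ℝ (Fin M ⊕ Fin M))
    (A : Matrix (Fin M ⊕ Fin M) (Fin M ⊕ Fin M) ℝ) (w : EuclideanSpace ℝ (Fin M ⊕ Fin M)) : ℝ :=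
  -A.trace - 2 * (phi g (‖w‖ ^ 2) * inner ℝ β w + phi g (‖w‖ ^ 2) * (w ⬝ᵥ A *ᵥ w))

lemma aestronglyMeasurable_phi_norm_sq (hM : 0 < M) (hg : IsDensityGenerator M g) :
    AEStronglyMeasurable (fun w : EuclideanSpace ℝ (Fin M ⊕ Fin M) => phi g (‖w‖ ^ 2))
      (sphericalLaw M g) :=
  aestronglyMeasurable_sphericalLaw hM hg.measurableOnPos_phi

lemma aestronglyMeasurable_phi_norm_sq_sq (hM : 0 < M) (hg : IsDensityGenerator M g) :
    AEStronglyMeasurable (fun w : EuclideanSpace ℝ (Fin M ⊕ Fin M) => phi g (‖w‖ ^ 2) ^ 2)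
      (sphericalLaw M g) :=
  (aestronglyMeasurable_phi_norm_sq hM hg).pow 2

section

variable (hM : 0 < M) (hg : IsDensityGenerator M g)
include hM hg

section

variable (hQ1 : Integrable (fun t : ℝ => t * phi g t ^ 2) (modularLaw M g))
include hQ1

lemma integrable_phi_sq_mul_norm_sq :
    Integrable (fun w => phi g (‖w‖ ^ 2) ^ 2 * ‖w‖ ^ 2) (sphericalLaw M g) := by
  simpa only [mul_comm] using (integrable_sphericalLaw_iff hM hg _).2 hQ1

lemma memLp_phi_mul_inner (β : EuclideanSpace ℝ (Fin M ⊕ Fin M)) :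
    MemLp (fun w => phi g (‖w‖ ^ 2) * inner ℝ β w) 2 (sphericalLaw M g) := by
  have hφ := aestronglyMeasurable_phi_norm_sq hM hg
  have hm : AEStronglyMeasurable (fun w => phi g (‖w‖ ^ 2) * inner ℝ β w) (sphericalLaw M g) :=
    hφ.mul (by fun_prop)
  rw [memLp_two_iff_integrable_sq hm]
  refine (integrable_radial_mul_coord_mul_coord
    (aestronglyMeasurable_phi_norm_sq_sq hM hg) (integrable_phi_sq_mul_norm_sq hM hg hQ1) β β).congr
    (.of_forall fun w => ?_)
  ring

/-- The product of two linear forms is the quadratic form of the rank one matrix `vecMulVec β γ`,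
whose trace is `⟪β, γ⟫`; the dimension is `2 M`. -/
lemma integral_phi_mul_inner_mul_phi_mul_inner (β γ : EuclideanSpace ℝ (Fin M ⊕ Fin M)) :
    2 * M * ∫ w, (phi g (‖w‖ ^ 2) * inner ℝ β w) * (phi g (‖w‖ ^ 2) * inner ℝ γ w)
        ∂sphericalLaw M g =
      (∫ t, t * phi g t ^ 2 ∂modularLaw M g) * inner ℝ β γ := by
  have : Nonempty (Fin M) := ⟨⟨0, hM⟩⟩
  have h := ((isRotationInvariant_sphericalLaw (M := M) (g := g)).integral_quadForm
    (H := fun w => phi g (‖w‖ ^ 2) ^ 2) (isRadial_norm fun r => phi g (r ^ 2) ^ 2)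
    (aestronglyMeasurable_phi_norm_sq_sq hM hg)
    (integrable_phi_sq_mul_norm_sq hM hg hQ1) (vecMulVec β γ)).2
  have h1 := integral_sphericalLaw hM hg fun t => t * phi g t ^ 2
  have h2 : (vecMulVec β γ : Matrix (Fin M ⊕ Fin M) (Fin M ⊕ Fin M) ℝ).trace = inner ℝ β γ := by
    rw [trace_vecMulVec, EuclideanSpace.inner_eq_star_dotProduct, dotProduct_comm]
    simp
  have h3 : ∀ w : EuclideanSpace ℝ (Fin M ⊕ Fin M),
      w ⬝ᵥ vecMulVec β γ *ᵥ w = inner ℝ β w * inner ℝ γ w := fun w => by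
    rw [vecMulVec_mulVec, EuclideanSpace.inner_eq_star_dotProduct,
      EuclideanSpace.inner_eq_star_dotProduct]
    simp [dotProduct_comm, mul_comm]
  simp only [h2, h3] at h
  rw [← h1]
  simp only [mul_comm (‖_‖ ^ 2)]
  rw [← h]
  simp only [Fintype.card_sum, Fintype.card_fin, Nat.cast_add]
  rw [two_mul]
  congr 1
  refine integral_congr_ae (.of_forall fun w => ?_)
  simp only
  ring

end

variable (hQ2 : Integrable (fun t : ℝ => t ^ 2 * phi g t ^ 2) (modularLaw M g))
include hQ2

lemma integrable_phi_sq_mul_norm_pow_four :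
    Integrable (fun w => phi g (‖w‖ ^ 2) ^ 2 * ‖w‖ ^ 4) (sphericalLaw M g) := by
  refine ((integrable_sphericalLaw_iff hM hg _).2 hQ2).congr (.of_forall fun w => ?_)
  simp only
  ring

lemma memLp_phi_mul_quadForm {A : Matrix (Fin M ⊕ Fin M) (Fin M ⊕ Fin M) ℝ} (hA : Aᵀ = A) :
    MemLp (fun w : EuclideanSpace ℝ (Fin M ⊕ Fin M) => phi g (‖w‖ ^ 2) * (w ⬝ᵥ A *ᵥ w)) 2
      (sphericalLaw M g) := by
  have : Nonempty (Fin M) := ⟨⟨0, hM⟩⟩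
  have hφ := aestronglyMeasurable_phi_norm_sq hM hg
  have hq : Continuous fun w : EuclideanSpace ℝ (Fin M ⊕ Fin M) => w ⬝ᵥ A *ᵥ w := by
    simp only [quadForm_eq_sum]
    fun_prop
  have hm : AEStronglyMeasurable (fun w : EuclideanSpace ℝ (Fin M ⊕ Fin M) =>
      phi g (‖w‖ ^ 2) * (w ⬝ᵥ A *ᵥ w)) (sphericalLaw M g) := hφ.mul hq.aestronglyMeasurable
  rw [memLp_two_iff_integrable_sq hm]
  refine ((isRotationInvariant_sphericalLaw (M := M) (g := g)).integral_quadForm_mul_quadForm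
    (H := fun w => phi g (‖w‖ ^ 2) ^ 2) (isRadial_norm fun r => phi g (r ^ 2) ^ 2)
    (aestronglyMeasurable_phi_norm_sq_sq hM hg)
    (integrable_phi_sq_mul_norm_pow_four hM hg hQ2) A A hA).1.congr (.of_forall fun w => ?_)
  simp only
  ring

lemma integral_phi_mul_quadForm_mul_phi_mul_quadForm
    (A B : Matrix (Fin M ⊕ Fin M) (Fin M ⊕ Fin M) ℝ) (hB : Bᵀ = B) :
    4 * (M * (M + 1)) * ∫ w : EuclideanSpace ℝ (Fin M ⊕ Fin M),
        (phi g (‖w‖ ^ 2) * (w ⬝ᵥ A *ᵥ w)) * (phi g (‖w‖ ^ 2) * (w ⬝ᵥ B *ᵥ w)) ∂sphericalLaw M g =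
      (∫ t, t ^ 2 * phi g t ^ 2 ∂modularLaw M g) * (A.trace * B.trace + 2 * (A * B).trace) := by
  have : Nonempty (Fin M) := ⟨⟨0, hM⟩⟩
  have h := ((isRotationInvariant_sphericalLaw (M := M) (g := g)).integral_quadForm_mul_quadForm
    (H := fun w => phi g (‖w‖ ^ 2) ^ 2) (isRadial_norm fun r => phi g (r ^ 2) ^ 2)
    (aestronglyMeasurable_phi_norm_sq_sq hM hg)
    (integrable_phi_sq_mul_norm_pow_four hM hg hQ2) A B hB).2
  have h1 : ∫ w : EuclideanSpace ℝ (Fin M ⊕ Fin M), phi g (‖w‖ ^ 2) ^ 2 * ‖w‖ ^ 4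
      ∂sphericalLaw M g = ∫ t, t ^ 2 * phi g t ^ 2 ∂modularLaw M g := by
    rw [← integral_sphericalLaw hM hg]
    refine integral_congr_ae (.of_forall fun w => ?_)
    simp only
    ring
  rw [h1] at h
  rw [← h]
  simp only [Fintype.card_sum, Fintype.card_fin, Nat.cast_add]
  -- This is `n (n + 2)` for the real dimension `n = 2 M`.
  rw [show (4 * (M * (M + 1)) : ℝ) = (M + M) * (M + M + 2) by ring]
  congr 1
  refine integral_congr_ae (.of_forall fun w => ?_)
  simp only
  ring

/-- The radial factor has mean `E[Q φ(Q)] = -M`, and the dimension is `2 M`. -/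
lemma integral_phi_mul_quadForm (A : Matrix (Fin M ⊕ Fin M) (Fin M ⊕ Fin M) ℝ) :
    ∫ w : EuclideanSpace ℝ (Fin M ⊕ Fin M), phi g (‖w‖ ^ 2) * (w ⬝ᵥ A *ᵥ w) ∂sphericalLaw M g =
      -A.trace / 2 := by
  have : Nonempty (Fin M) := ⟨⟨0, hM⟩⟩
  have hI : Integrable (fun w => phi g (‖w‖ ^ 2) * ‖w‖ ^ 2) (sphericalLaw M g) := by
    simpa only [mul_comm] using
      (integrable_sphericalLaw_iff hM hg _).2 (integrable_mul_phi hg hQ2)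
  have h := ((isRotationInvariant_sphericalLaw (M := M) (g := g)).integral_quadForm
    (H := fun w => phi g (‖w‖ ^ 2)) (isRadial_norm fun r => phi g (r ^ 2))
    (aestronglyMeasurable_phi_norm_sq hM hg) hI A).2
  have h1 := integral_sphericalLaw hM hg fun t => t * phi g t
  rw [integral_mul_phi hM hg hQ2] at h1
  simp only [mul_comm (‖_‖ ^ 2)] at h1
  rw [h1] at h
  simp only [Fintype.card_sum, Fintype.card_fin, Nat.cast_add] at h
  have hM' : (M : ℝ) ≠ 0 := by positivity
  apply mul_left_cancel₀ hM'
  linarith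

variable (hQ1 : Integrable (fun t : ℝ => t * phi g t ^ 2) (modularLaw M g))
include hQ1

lemma memLp_whitenedScore (β : EuclideanSpace ℝ (Fin M ⊕ Fin M))
    {A : Matrix (Fin M ⊕ Fin M) (Fin M ⊕ Fin M) ℝ} (hA : Aᵀ = A) :
    MemLp (whitenedScore g β A) 2 (sphericalLaw M g) := by
  have := isProbabilityMeasure_sphericalLaw hM hg
  exact (memLp_const (-A.trace)).sub
    (((memLp_phi_mul_inner hM hg hQ1 β).add (memLp_phi_mul_quadForm hM hg hQ2 hA)).const_mul 2)

omit hM hg hQ1 hQ2 in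
lemma quadForm_neg (A : Matrix (Fin M ⊕ Fin M) (Fin M ⊕ Fin M) ℝ)
    (w : EuclideanSpace ℝ (Fin M ⊕ Fin M)) : (-w).ofLp ⬝ᵥ A *ᵥ (-w).ofLp = w ⬝ᵥ A *ᵥ w := by
  rw [WithLp.ofLp_neg, mulVec_neg, neg_dotProduct_neg]

omit hM hg hQ1 hQ2 in
lemma integral_phi_mul_inner (β : EuclideanSpace ℝ (Fin M ⊕ Fin M)) :
    ∫ w, phi g (‖w‖ ^ 2) * inner ℝ β w ∂sphericalLaw M g = 0 :=
  isRotationInvariant_sphericalLaw.integral_eq_zero_of_odd fun w => by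
    rw [norm_neg, inner_neg_right]
    ring

omit hM hg hQ1 hQ2 in
lemma integral_phi_mul_inner_mul_phi_mul_quadForm (β : EuclideanSpace ℝ (Fin M ⊕ Fin M))
    (A : Matrix (Fin M ⊕ Fin M) (Fin M ⊕ Fin M) ℝ) :
    ∫ w : EuclideanSpace ℝ (Fin M ⊕ Fin M),
      (phi g (‖w‖ ^ 2) * inner ℝ β w) * (phi g (‖w‖ ^ 2) * (w ⬝ᵥ A *ᵥ w)) ∂sphericalLaw M g = 0 :=
  isRotationInvariant_sphericalLaw.integral_eq_zero_of_odd fun w => by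
    rw [norm_neg, inner_neg_right, quadForm_neg]
    ring

lemma integral_whitenedScore (β : EuclideanSpace ℝ (Fin M ⊕ Fin M))
    {A : Matrix (Fin M ⊕ Fin M) (Fin M ⊕ Fin M) ℝ} (hA : Aᵀ = A) :
    ∫ w, whitenedScore g β A w ∂sphericalLaw M g = 0 := by
  have := isProbabilityMeasure_sphericalLaw hM hg
  have hX := (memLp_phi_mul_inner hM hg hQ1 β).integrable one_le_two
  have hY := (memLp_phi_mul_quadForm hM hg hQ2 hA).integrable one_le_two
  have hXY : Integrable (fun w : EuclideanSpace ℝ (Fin M ⊕ Fin M) =>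
      phi g (‖w‖ ^ 2) * inner ℝ β w + phi g (‖w‖ ^ 2) * (w ⬝ᵥ A *ᵥ w)) (sphericalLaw M g) :=
    hX.add hY
  simp only [whitenedScore]
  rw [integral_sub (integrable_const _) (hXY.const_mul 2), integral_const_mul,
    integral_add hX hY, integral_phi_mul_inner, integral_phi_mul_quadForm hM hg hQ2]
  simp
  ring

/-- The linear and quadratic parts are orthogonal by parity. Each quadratic part has mean minus half
its trace, so each of the two products with a constant contributes `-tr A * tr B`. Together with the
product of the constants this leaves `-tr A * tr B`. -/
lemma integral_whitenedScore_mul_whitenedScore (β γ : EuclideanSpace ℝ (Fin M ⊕ Fin M))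
    {A B : Matrix (Fin M ⊕ Fin M) (Fin M ⊕ Fin M) ℝ} (hA : Aᵀ = A) (hB : Bᵀ = B) :
    ∫ w, whitenedScore g β A w * whitenedScore g γ B w ∂sphericalLaw M g =
      (∫ t, t * phi g t ^ 2 ∂modularLaw M g) / M * (2 * inner ℝ β γ) +
      (∫ t, t ^ 2 * phi g t ^ 2 ∂modularLaw M g) / (4 * M * (M + 1)) *
        (4 * (A.trace * B.trace + 2 * (A * B).trace)) - A.trace * B.trace := by
  have := isProbabilityMeasure_sphericalLaw hM hg
  have hX := memLp_phi_mul_inner hM hg hQ1 β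
  have hY := memLp_phi_mul_quadForm hM hg hQ2 hA
  have hX' := memLp_phi_mul_inner hM hg hQ1 γ
  have hY' := memLp_phi_mul_quadForm hM hg hQ2 hB
  have e1 := integral_phi_mul_inner_mul_phi_mul_inner hM hg hQ1 β γ
  have e2 := integral_phi_mul_quadForm_mul_phi_mul_quadForm hM hg hQ2 A B hB
  have e3 := integral_phi_mul_inner_mul_phi_mul_quadForm (g := g) β B
  have e4 := integral_phi_mul_inner_mul_phi_mul_quadForm (g := g) γ A
  have e5 := integral_phi_mul_inner (g := g) β
  have e6 := integral_phi_mul_inner (g := g) γ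
  have e7 := integral_phi_mul_quadForm hM hg hQ2 A
  have e8 := integral_phi_mul_quadForm hM hg hQ2 B
  simp only [whitenedScore]
  set X := fun w : EuclideanSpace ℝ (Fin M ⊕ Fin M) => phi g (‖w‖ ^ 2) * inner ℝ β w
  set X' := fun w : EuclideanSpace ℝ (Fin M ⊕ Fin M) => phi g (‖w‖ ^ 2) * inner ℝ γ w
  set Y := fun w : EuclideanSpace ℝ (Fin M ⊕ Fin M) => phi g (‖w‖ ^ 2) * (w ⬝ᵥ A *ᵥ w)
  set Y' := fun w : EuclideanSpace ℝ (Fin M ⊕ Fin M) => phi g (‖w‖ ^ 2) * (w ⬝ᵥ B *ᵥ w)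
  have hexp : ∀ w, (-A.trace - 2 * (X w + Y w)) * (-B.trace - 2 * (X' w + Y' w)) =
      (A.trace * B.trace + 2 * B.trace * (X w + Y w) + 2 * A.trace * (X' w + Y' w)) +
      4 * ((X w * X' w + X w * Y' w) + (X' w * Y w + Y w * Y' w)) := fun w => by ring
  have i1 : Integrable (fun w => X w + Y w) (sphericalLaw M g) :=
    (hX.add hY).integrable one_le_two
  have i2 : Integrable (fun w => X' w + Y' w) (sphericalLaw M g) :=
    (hX'.add hY').integrable one_le_two
  have j1 : Integrable (fun w => X w * X' w) (sphericalLaw M g) := hX.integrable_mul hX'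
  have j2 : Integrable (fun w => X w * Y' w) (sphericalLaw M g) := hX.integrable_mul hY'
  have j3 : Integrable (fun w => X' w * Y w) (sphericalLaw M g) := hX'.integrable_mul hY
  have j4 : Integrable (fun w => Y w * Y' w) (sphericalLaw M g) := hY.integrable_mul hY'
  have hsum : ∫ w, (-A.trace - 2 * (X w + Y w)) * (-B.trace - 2 * (X' w + Y' w))
      ∂sphericalLaw M g = (A.trace * B.trace + 2 * B.trace * (∫ w, X w ∂sphericalLaw M g +
        ∫ w, Y w ∂sphericalLaw M g) + 2 * A.trace * (∫ w, X' w ∂sphericalLaw M g +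
        ∫ w, Y' w ∂sphericalLaw M g)) + 4 * ((∫ w, X w * X' w ∂sphericalLaw M g +
        ∫ w, X w * Y' w ∂sphericalLaw M g) + (∫ w, X' w * Y w ∂sphericalLaw M g +
        ∫ w, Y w * Y' w ∂sphericalLaw M g)) := by
    simp_rw [hexp]
    have k1 : Integrable (fun w => A.trace * B.trace + 2 * B.trace * (X w + Y w))
        (sphericalLaw M g) := (integrable_const _).add (i1.const_mul _)
    have k2 : Integrable (fun w => A.trace * B.trace + 2 * B.trace * (X w + Y w) +
        2 * A.trace * (X' w + Y' w)) (sphericalLaw M g) := k1.add (i2.const_mul _)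
    have k3 : Integrable (fun w => X w * X' w + X w * Y' w) (sphericalLaw M g) := j1.add j2
    have k4 : Integrable (fun w => X' w * Y w + Y w * Y' w) (sphericalLaw M g) := j3.add j4
    have k5 : Integrable (fun w => (X w * X' w + X w * Y' w) + (X' w * Y w + Y w * Y' w))
        (sphericalLaw M g) := k3.add k4
    rw [integral_add k2 (k5.const_mul 4), integral_add k1 (i2.const_mul _),
      integral_add (integrable_const _) (i1.const_mul _), integral_const_mul, integral_const_mul,
      integral_const_mul, integral_const_mul, integral_add k3 k4, integral_add j1 j2,
      integral_add j3 j4, integral_add (hX.integrable one_le_two) (hY.integrable one_le_two),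
      integral_add (hX'.integrable one_le_two) (hY'.integrable one_le_two)]
    simp
  have hM' : (M : ℝ) ≠ 0 := by positivity
  have hM1 : (M : ℝ) + 1 ≠ 0 := by positivity
  have e1' : ∫ w, X w * X' w ∂sphericalLaw M g =
      (∫ t, t * phi g t ^ 2 ∂modularLaw M g) * inner ℝ β γ / (2 * M) := by
    rw [eq_div_iff (by positivity), ← e1, mul_comm]
  have e2' : ∫ w, Y w * Y' w ∂sphericalLaw M g =
      (∫ t, t ^ 2 * phi g t ^ 2 ∂modularLaw M g) * (A.trace * B.trace + 2 * (A * B).trace) /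
        (4 * (M * (M + 1))) := by
    rw [eq_div_iff (by positivity), ← e2, mul_comm]
  rw [hsum, e1', e2', e3, e4, e5, e6, e7, e8]
  field_simp
  ring

end

end SphericalScore

/-! ### Differentiating the log-likelihood along coordinate lines -/

section Score

open Filter Topology

variable {M d : ℕ}

lemma lineDifferentiableAt_star {f : (Fin d → ℝ) → ℂ} {α v : Fin d → ℝ} :
    LineDifferentiableAt ℝ f α v → LineDifferentiableAt ℝ (fun b => star (f b)) α v :=
  fun h => DifferentiableAt.star h

lemma pderiv_star (k : Fin d) (f : (Fin d → ℝ) → ℂ) (α : Fin d → ℝ) :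
    pderiv k (fun b => star (f b)) α = star (pderiv k f α) :=
  deriv.star

section

variable {m : (Fin d → ℝ) → Fin M → ℂ} {S W : (Fin d → ℝ) → Matrix (Fin M) (Fin M) ℂ}
  {α : Fin d → ℝ} {k : Fin d}

lemma hasDerivAt_aug (hm : ∀ i, HasPartial k (fun a => m a i) α) (i : Fin M ⊕ Fin M) :
    HasDerivAt (fun t : ℝ => aug (m (α + t • Pi.single k 1)) i) (dMu k m α i) 0 := by
  have h : LineDifferentiableAt ℝ (fun b => aug (m b) i) α (Pi.single k 1) := by
    rcases i with i | i
    · exact hm i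
    · exact lineDifferentiableAt_star (hm i)
  exact h.hasLineDerivAt

lemma hasDerivAt_augScatter (hS : ∀ i j, HasPartial k (fun a => S a i j) α)
    (hW : ∀ i j, HasPartial k (fun a => W a i j) α) (i j : Fin M ⊕ Fin M) :
    HasDerivAt (fun t : ℝ => augScatter (S (α + t • Pi.single k 1)) (W (α + t • Pi.single k 1)) i j)
      (dGamma k S W α i j) 0 := by
  have h : LineDifferentiableAt ℝ (fun b => augScatter (S b) (W b) i j) α (Pi.single k 1) := by
    rcases i with i | i <;> rcases j with j | j
    · exact hS i j
    · exact hW i j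
    · exact lineDifferentiableAt_star (hW i j)
    · exact lineDifferentiableAt_star (hS i j)
  exact h.hasLineDerivAt

lemma star_dMu : star (dMu k m α) = dMu k m α ∘ Sum.swap := by
  ext i
  rw [Pi.star_apply, dMu, ← pderiv_star]
  rcases i with i | i <;> simp [aug, dMu]

lemma dGamma_map_star : (dGamma k S W α).map star =
    (dGamma k S W α).submatrix (Equiv.sumComm _ _) (Equiv.sumComm _ _) := by
  ext i j
  rw [map_apply, dGamma, of_apply, ← pderiv_star]
  rcases i with i | i <;> rcases j with j | j <;> simp [augScatter]

lemma eventually_line {p : (Fin d → ℝ) → Prop} {v : Fin d → ℝ} (h : ∀ᶠ a in 𝓝 α, p a) :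
    ∀ᶠ t : ℝ in 𝓝 0, p (α + t • v) := by
  have hc : Tendsto (fun t : ℝ => α + t • v) (𝓝 0) (𝓝 α) := by
    have : Continuous fun t : ℝ => α + t • v := by fun_prop
    simpa using this.tendsto 0
  exact hc.eventually h

/-- Entries at transposed positions are conjugate throughout a neighbourhood, so their derivatives
are conjugate; the hypothesis at `α` alone would not suffice. -/
lemma dGamma_isHermitian (h : ∀ᶠ a in 𝓝 α, (augScatter (S a) (W a)).IsHermitian) :
    (dGamma k S W α).IsHermitian := by
  ext i j
  rw [conjTranspose_apply, dGamma, of_apply, of_apply, ← pderiv_star]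
  refine EventuallyEq.deriv_eq ?_
  filter_upwards [eventually_line h] with t ht
  exact ht.apply i j

/-- The derivative of `η` in the direction of the `k`-th parameter. -/
def etaDeriv (m : Fin M → ℂ) (S W : Matrix (Fin M) (Fin M) ℂ) (μ' : Fin M ⊕ Fin M → ℂ)
    (Γ' : Matrix (Fin M ⊕ Fin M) (Fin M ⊕ Fin M) ℂ) (z : Fin M → ℂ) : ℝ :=
  (1 / 2) * (star (-μ') ⬝ᵥ ((augScatter S W)⁻¹ *ᵥ (aug z - aug m)) +
    star (aug z - aug m) ⬝ᵥ ((augScatter S W)⁻¹ *ᵥ (-μ')) -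
    star (aug z - aug m) ⬝ᵥ
      (((augScatter S W)⁻¹ * Γ' * (augScatter S W)⁻¹) *ᵥ (aug z - aug m))).re

lemma hasDerivAt_re {f : ℝ → ℂ} {f' : ℂ} {t : ℝ} (h : HasDerivAt f f' t) :
    HasDerivAt (fun s => (f s).re) f'.re t :=
  Complex.reCLM.hasFDerivAt.comp_hasDerivAt t h

lemma hasDerivAt_eta (hm : ∀ i, HasPartial k (fun a => m a i) α)
    (hS : ∀ i j, HasPartial k (fun a => S a i j) α)
    (hW : ∀ i j, HasPartial k (fun a => W a i j) α)
    (hdet : IsUnit (augScatter (S α) (W α)).det) (z : Fin M → ℂ) :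
    HasDerivAt (fun t : ℝ => eta (m (α + t • Pi.single k 1)) (S (α + t • Pi.single k 1))
        (W (α + t • Pi.single k 1)) z)
      (etaDeriv (m α) (S α) (W α) (dMu k m α) (dGamma k S W α) z) 0 := by
  have h := hasDerivAt_quadForm (hasDerivAt_augScatter hS hW) (by simpa using hdet)
    (u := fun t => aug z - aug (m (α + t • Pi.single k 1))) (u' := -dMu k m α)
    (fun i => by simpa using (hasDerivAt_aug hm i).const_sub (aug z i))
  have h2 := (hasDerivAt_re h).const_mul (1 / 2)
  simp only [zero_smul, add_zero] at h2
  exact h2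

lemma hasLineDerivAt_logLik {g : ℝ → ℝ} (hM : 0 < M) (hg : IsDensityGenerator M g)
    (hm : ∀ i, HasPartial k (fun a => m a i) α)
    (hS : ∀ i j, HasPartial k (fun a => S a i j) α)
    (hW : ∀ i j, HasPartial k (fun a => W a i j) α)
    (hpos : (augScatter (S α) (W α)).PosDef) (z : Fin M → ℂ)
    (hη : 0 < eta (m α) (S α) (W α) z) (hgη : 0 < g (eta (m α) (S α) (W α) z)) :
    HasLineDerivAt ℝ (logLik g m S W z)
      (-(1 / 2) * ((augScatter (S α) (W α))⁻¹ * dGamma k S W α).trace.re +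
        phi g (eta (m α) (S α) (W α) z) *
          etaDeriv (m α) (S α) (W α) (dMu k m α) (dGamma k S W α) z) α (Pi.single k 1) := by
  set v : Fin d → ℝ := Pi.single k 1
  have hα : α + (0 : ℝ) • v = α := by simp
  have hdetpos : 0 < (augScatter (S α) (W α)).det := hpos.det_pos
  have hdet : IsUnit (augScatter (S α) (W α)).det := hdetpos.ne'.isUnit
  have hre : 0 < (augScatter (S α) (W α)).det.re := (Complex.lt_def.1 hdetpos).1
  have him : (augScatter (S α) (W α)).det.im = 0 := (Complex.lt_def.1 hdetpos).2.symm
  have hD := hasDerivAt_re (hasDerivAt_det (hasDerivAt_augScatter (k := k) hS hW)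
    (by simpa using hdet))
  have hE := hasDerivAt_eta (k := k) hm hS hW hdet z
  set D : ℝ → ℝ := fun t => (augScatter (S (α + t • v)) (W (α + t • v))).det.re
  set η : ℝ → ℝ := fun t => eta (m (α + t • v)) (S (α + t • v)) (W (α + t • v)) z
  have hη0 : η 0 = eta (m α) (S α) (W α) z := by simp only [η, hα]
  have hD0 : D 0 = (augScatter (S α) (W α)).det.re := by simp only [D, hα]
  have hgd : HasDerivAt g (deriv g (η 0)) (η 0) := by
    rw [hη0]
    exact (hg.differentiable.differentiableAt (Ioi_mem_nhds hη)).hasDerivAt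
  have hgη' : HasDerivAt (fun t => g (η t)) (deriv g (η 0) * etaDeriv (m α) (S α) (W α)
      (dMu k m α) (dGamma k S W α) z) 0 := hgd.comp 0 hE
  have hDne : D 0 ≠ 0 := by rw [hD0]; exact hre.ne'
  have hgne : g (η 0) ≠ 0 := by rw [hη0]; exact hgη.ne'
  have hlog := ((hD.log hDne).const_mul (-(1 / 2))).fun_add (hgη'.log hgne)
  have hlog' := hlog.const_add (Real.log (normConst M g))
  -- The logarithm splits only where the determinant is positive and `g (η t)` is nonzero.
  -- Differentiability at 0 along the line gives the continuity needed to keep both conditions for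
  -- small `t`.
  have hev : (fun t => logLik g m S W z (α + t • v)) =ᶠ[𝓝 0]
      fun t => Real.log (normConst M g) + (-(1 / 2) * Real.log (D t) + Real.log (g (η t))) := by
    filter_upwards [hD.continuousAt.eventually_ne hDne,
      hD.continuousAt.eventually (lt_mem_nhds (hD0 ▸ hre)),
      hgη'.continuousAt.eventually_ne hgne] with t h1 h2 h3
    have hc := (hg.normConst_pos hM).ne'
    have hr : D t ^ (-(1 / 2) : ℝ) ≠ 0 := (Real.rpow_pos_of_pos h2 _).ne'
    simp only [logLik, density]
    rw [Real.log_mul (mul_ne_zero hc hr) h3, Real.log_mul hc hr, Real.log_rpow h2]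
    ring
  refine (hlog'.congr_of_eventuallyEq hev).congr_deriv ?_
  -- The determinant at `α` is real, so the real part of Jacobi's formula factors.
  rw [hη0, hD0, hα, Complex.mul_re, him, phi]
  field_simp
  ring

end

end Score

/-! ### The quadratic form and its derivative in whitened coordinates -/

section Whitening

variable {M : ℕ}

lemma isWhitening_realToAug_mul {S W : Matrix (Fin M) (Fin M) ℂ}
    (h : (augScatter S W).PosDef) {R : Matrix (Fin M ⊕ Fin M) (Fin M ⊕ Fin M) ℝ}
    (hR : (realToAug M * R.map Complex.ofReal) * (realToAug M * R.map Complex.ofReal)ᴴ =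
      (2 : ℂ) • augScatter S W) :
    IsWhitening (realToAug M * R.map Complex.ofReal) (augScatter S W) where
  isUnit_det := by
    have h1 := congrArg det hR
    rw [det_mul, det_smul] at h1
    refine (left_ne_zero_of_mul (b := (realToAug M * R.map Complex.ofReal)ᴴ.det) ?_).isUnit
    rw [h1]
    exact mul_ne_zero (pow_ne_zero _ two_ne_zero) h.det_pos.ne'
  mul_conjTranspose := hR
  map_star := by
    have h1 : (R.map Complex.ofReal).map star = R.map Complex.ofReal := by
      ext i j
      simp
    rw [map_star_mul, h1, realToAug_map_star]
    exact submatrix_mul_equiv (realToAug M) (R.map Complex.ofReal) _ (Equiv.refl _) (Equiv.refl _)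

namespace IsWhitening

variable {C G : Matrix (Fin M ⊕ Fin M) (Fin M ⊕ Fin M) ℂ} (hC : IsWhitening C G)
include hC

lemma star_dotProduct_inv_mulVec (x y : Fin M ⊕ Fin M → ℂ) :
    star x ⬝ᵥ (G⁻¹ *ᵥ y) = 2 * (star (C⁻¹ *ᵥ x) ⬝ᵥ (C⁻¹ *ᵥ y)) := by
  rw [hC.inv_eq, smul_mulVec, dotProduct_smul, smul_eq_mul, ← mulVec_mulVec, dotProduct_mulVec,
    star_mulVec]

lemma star_dotProduct_inv_mul_mul_inv_mulVec (A : Matrix (Fin M ⊕ Fin M) (Fin M ⊕ Fin M) ℂ)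
    (x y : Fin M ⊕ Fin M → ℂ) :
    star x ⬝ᵥ ((G⁻¹ * A * G⁻¹) *ᵥ y) =
      4 * (star (C⁻¹ *ᵥ x) ⬝ᵥ ((C⁻¹ * A * C⁻¹ᴴ) *ᵥ (C⁻¹ *ᵥ y))) := by
  have h : G⁻¹ * A * G⁻¹ = (4 : ℂ) • (C⁻¹ᴴ * ((C⁻¹ * A * C⁻¹ᴴ) * C⁻¹)) := by
    rw [hC.inv_eq]
    simp only [Matrix.mul_smul, Matrix.smul_mul, smul_smul, Matrix.mul_assoc]
    norm_num
  rw [h, smul_mulVec, dotProduct_smul, smul_eq_mul, ← mulVec_mulVec, ← mulVec_mulVec,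
    dotProduct_mulVec (star x), star_mulVec]

end IsWhitening

lemma ofReal_dotProduct {ι : Type*} [Fintype ι] (x y : ι → ℝ) :
    (Complex.ofReal ∘ x) ⬝ᵥ (Complex.ofReal ∘ y) = ((x ⬝ᵥ y : ℝ) : ℂ) := by
  simp [dotProduct]

lemma star_ofReal_comp {ι : Type*} (x : ι → ℝ) :
    star (Complex.ofReal ∘ x) = Complex.ofReal ∘ x := by
  ext i
  simp

lemma map_ofReal_mulVec {ι : Type*} [Fintype ι] (A : Matrix ι ι ℝ) (x : ι → ℝ) :
    A.map Complex.ofReal *ᵥ (Complex.ofReal ∘ x) = Complex.ofReal ∘ (A *ᵥ x) := by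
  ext i
  simp [mulVec, dotProduct]

lemma trace_map_ofReal {ι : Type*} [Fintype ι] (A : Matrix ι ι ℝ) :
    (A.map Complex.ofReal).trace = (A.trace : ℂ) := by
  simp [Matrix.trace]

lemma aug_affineEquiv (m : Fin M → ℂ) (R : Matrix (Fin M ⊕ Fin M) (Fin M ⊕ Fin M) ℝ)
    (hR : R.det ≠ 0) (w : EuclideanSpace ℝ (Fin M ⊕ Fin M)) :
    aug (affineEquiv m R hR w) - aug m =
      (realToAug M * R.map Complex.ofReal) *ᵥ (Complex.ofReal ∘ w) := by
  have h : ∀ y : Fin M → ℂ, aug (m + y) - aug m = aug y := fun y => by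
    ext i
    rcases i with i | i <;> simp [aug]
  rw [affineEquiv_apply, h, aug_ofRealCoords, ← mulVec_mulVec, map_ofReal_mulVec]

variable {C : Matrix (Fin M ⊕ Fin M) (Fin M ⊕ Fin M) ℂ} {m : Fin M → ℂ}
  {S W : Matrix (Fin M) (Fin M) ℂ} (hC : IsWhitening C (augScatter S W))
include hC

lemma eta_eq_norm_sq {z : Fin M → ℂ} {w : EuclideanSpace ℝ (Fin M ⊕ Fin M)}
    (hz : aug z - aug m = C *ᵥ (Complex.ofReal ∘ w)) : eta m S W z = ‖w‖ ^ 2 := by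
  rw [eta, hC.star_dotProduct_inv_mulVec, hz, mulVec_mulVec, nonsing_inv_mul _ hC.isUnit_det,
    one_mulVec, star_ofReal_comp, ofReal_dotProduct, EuclideanSpace.real_norm_sq_eq]
  simp [dotProduct, pow_two]

lemma etaDeriv_eq {z : Fin M → ℂ} {w β : EuclideanSpace ℝ (Fin M ⊕ Fin M)}
    {A : Matrix (Fin M ⊕ Fin M) (Fin M ⊕ Fin M) ℝ} {μ' : Fin M ⊕ Fin M → ℂ}
    {Γ' : Matrix (Fin M ⊕ Fin M) (Fin M ⊕ Fin M) ℂ}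
    (hz : aug z - aug m = C *ᵥ (Complex.ofReal ∘ w))
    (hβ : Complex.ofReal ∘ β = C⁻¹ *ᵥ μ') (hA : A.map Complex.ofReal = C⁻¹ * Γ' * C⁻¹ᴴ) :
    etaDeriv m S W μ' Γ' z = -(2 * (inner ℝ β w + w ⬝ᵥ A *ᵥ w)) := by
  have h1 : C⁻¹ *ᵥ (aug z - aug m) = Complex.ofReal ∘ w := by
    rw [hz, mulVec_mulVec, nonsing_inv_mul _ hC.isUnit_det, one_mulVec]
  have h2 : w.ofLp ⬝ᵥ β.ofLp = inner ℝ β w := by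
    rw [EuclideanSpace.inner_eq_star_dotProduct]
    simp
  rw [etaDeriv, hC.star_dotProduct_inv_mulVec, hC.star_dotProduct_inv_mulVec,
    hC.star_dotProduct_inv_mul_mul_inv_mulVec, h1, mulVec_neg, ← hβ, ← hA, map_ofReal_mulVec,
    star_neg, star_ofReal_comp, star_ofReal_comp, neg_dotProduct, dotProduct_neg,
    ofReal_dotProduct, ofReal_dotProduct, ofReal_dotProduct, dotProduct_comm β.ofLp, h2,
    ← Complex.ofReal_neg]
  norm_cast
  ring

end Whitening

end NCCES

end

/-! ### Assembly of the Fisher information -/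

theorem mainTheorem1 {M d : ℕ} (hM : 0 < M) (g : ℝ → ℝ) (hg : NCCES.IsDensityGenerator M g)
    (hQ1 : Integrable (fun t : ℝ => t * NCCES.phi g t ^ 2) (NCCES.modularLaw M g))
    (hQ2 : Integrable (fun t : ℝ => t ^ 2 * NCCES.phi g t ^ 2) (NCCES.modularLaw M g))
    (Θ : Set (Fin d → ℝ)) (hΘ : IsOpen Θ)
    (m : (Fin d → ℝ) → Fin M → ℂ) (S W : (Fin d → ℝ) → Matrix (Fin M) (Fin M) ℂ)
    (hpos : ∀ a ∈ Θ, (NCCES.augScatter (S a) (W a)).PosDef)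
    (α : Fin d → ℝ) (hα : α ∈ Θ)
    (hm : ∀ k i, NCCES.HasPartial k (fun a => m a i) α)
    (hS : ∀ k i j, NCCES.HasPartial k (fun a => S a i j) α)
    (hW : ∀ k i j, NCCES.HasPartial k (fun a => W a i j) α) :
    IsProbabilityMeasure (NCCES.law g (m α) (S α) (W α)) ∧
    (∀ k, ∀ᵐ z ∂(NCCES.law g (m α) (S α) (W α)),
      NCCES.HasPartial k (NCCES.logLik g m S W z) α) ∧
    (∀ k, Integrable (NCCES.score g m S W α k) (NCCES.law g (m α) (S α) (W α)) ∧
      ∫ z, NCCES.score g m S W α k z ∂(NCCES.law g (m α) (S α) (W α)) = 0) ∧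
    (∀ k l, Integrable (fun z => NCCES.score g m S W α k z * NCCES.score g m S W α l z)
        (NCCES.law g (m α) (S α) (W α)) ∧
      (NCCES.fisherInfo g m S W α k l : ℂ) =
        (((∫ t, t * NCCES.phi g t ^ 2 ∂(NCCES.modularLaw M g)) / M *
          (star (NCCES.dMu k m α) ⬝ᵥ
            ((NCCES.augScatter (S α) (W α))⁻¹ *ᵥ NCCES.dMu l m α)).re : ℝ) : ℂ) +
        (((∫ t, t ^ 2 * NCCES.phi g t ^ 2 ∂(NCCES.modularLaw M g)) / (4 * M * (M + 1)) : ℝ) : ℂ) *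
          ((NCCES.dGamma k S W α * (NCCES.augScatter (S α) (W α))⁻¹).trace *
              (NCCES.dGamma l S W α * (NCCES.augScatter (S α) (W α))⁻¹).trace +
            2 * (NCCES.dGamma k S W α * (NCCES.augScatter (S α) (W α))⁻¹ *
              NCCES.dGamma l S W α * (NCCES.augScatter (S α) (W α))⁻¹).trace) -
        1 / 4 * ((NCCES.augScatter (S α) (W α))⁻¹ * NCCES.dGamma k S W α).trace *
          ((NCCES.augScatter (S α) (W α))⁻¹ * NCCES.dGamma l S W α).trace) := by
  have hΓ := hpos α hα
  obtain ⟨R, hRdet, hRR⟩ := NCCES.exists_whitening hΓ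
  have hC := NCCES.isWhitening_realToAug_mul hΓ hRR
  have hRne : R.det ≠ 0 := by
    intro h0
    rw [h0] at hRdet
    have := (Complex.lt_def.1 hΓ.det_pos).1
    simp at this hRdet
    linarith
  set C := NCCES.realToAug M * R.map Complex.ofReal
  set Ψ := NCCES.affineEquiv (m α) R hRne
  have haug : ∀ w, NCCES.aug (Ψ w) - NCCES.aug (m α) = C *ᵥ (Complex.ofReal ∘ w) :=
    NCCES.aug_affineEquiv (m α) R hRne
  have heta : ∀ w, NCCES.eta (m α) (S α) (W α) (Ψ w) = ‖w‖ ^ 2 := fun w =>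
    NCCES.eta_eq_norm_sq hC (haug w)
  have hlaw := NCCES.law_eq_map g (m α) (S α) (W α) R hRne hRdet heta
  have hherm : ∀ᶠ a in nhds α, (NCCES.augScatter (S a) (W a)).IsHermitian := by
    filter_upwards [hΘ.mem_nhds hα] with a ha
    exact (hpos a ha).1
  set G := NCCES.augScatter (S α) (W α)
  -- whitened derivatives of the location vector and of the scatter matrix
  have hβ : ∀ k, ∃ β : EuclideanSpace ℝ (Fin M ⊕ Fin M),
      Complex.ofReal ∘ β = C⁻¹ *ᵥ NCCES.dMu k m α := fun k => by
    refine ⟨WithLp.toLp 2 fun i => ((C⁻¹ *ᵥ NCCES.dMu k m α) i).re, ?_⟩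
    funext i
    exact Complex.conj_eq_iff_re.1 (congrFun (hC.star_inv_mulVec NCCES.star_dMu) i)
  -- Reality comes from the conjugation symmetry of the extended scatter matrix; symmetry then comes
  -- from its being Hermitian near `α`, where openness of `Θ` enters.
  have hA : ∀ k, ∃ A : Matrix (Fin M ⊕ Fin M) (Fin M ⊕ Fin M) ℝ,
      A.map Complex.ofReal = C⁻¹ * NCCES.dGamma k S W α * C⁻¹ᴴ ∧ Aᵀ = A := fun k => by
    have hr := hC.whiten_map_star (NCCES.dGamma_map_star (k := k) (S := S) (W := W) (α := α))
    have hh : (C⁻¹ * NCCES.dGamma k S W α * C⁻¹ᴴ)ᴴ = C⁻¹ * NCCES.dGamma k S W α * C⁻¹ᴴ := by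
      rw [conjTranspose_mul, conjTranspose_mul, conjTranspose_conjTranspose,
        NCCES.dGamma_isHermitian hherm, Matrix.mul_assoc]
    refine ⟨(C⁻¹ * NCCES.dGamma k S W α * C⁻¹ᴴ).map Complex.re, ?_, ?_⟩
    · ext i j
      exact Complex.conj_eq_iff_re.1 (congrFun (congrFun hr i) j)
    · ext i j
      have := congrArg Complex.re (congrFun (congrFun hh i) j)
      simpa [conjTranspose_apply] using this
  choose β hβ using hβ
  choose A hA hAt using hA
  -- The factors 2 and 4 below come from one or two occurrences of `G⁻¹ = 2 • (C⁻¹ᴴ * C⁻¹)`. They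
  -- turn `-tr A * tr B` into the term with coefficient `-1/4`.
  have htr : ∀ k, (NCCES.dGamma k S W α * G⁻¹).trace = ((2 * (A k).trace : ℝ) : ℂ) := fun k => by
    rw [← hC.trace_whiten, ← hA, NCCES.trace_map_ofReal]
    push_cast
    rfl
  have htr' : ∀ k, (G⁻¹ * NCCES.dGamma k S W α).trace = ((2 * (A k).trace : ℝ) : ℂ) := fun k => by
    rw [trace_mul_comm, htr]
  have htr2 : ∀ k l, (NCCES.dGamma k S W α * G⁻¹ * NCCES.dGamma l S W α * G⁻¹).trace =
      ((4 * (A k * A l).trace : ℝ) : ℂ) := fun k l => by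
    have : (A k * A l).map Complex.ofReal = (A k).map Complex.ofReal * (A l).map Complex.ofReal :=
      Matrix.map_mul (f := Complex.ofRealHom)
    rw [← hC.trace_whiten_mul, ← hA, ← hA, ← this, NCCES.trace_map_ofReal]
    push_cast
    rfl
  have hinner : ∀ k l, (star (NCCES.dMu k m α) ⬝ᵥ (G⁻¹ *ᵥ NCCES.dMu l m α)).re =
      2 * inner ℝ (β k) (β l) := fun k l => by
    rw [hC.star_dotProduct_inv_mulVec, ← hβ, ← hβ, NCCES.star_ofReal_comp,
      NCCES.ofReal_dotProduct, EuclideanSpace.inner_eq_star_dotProduct, dotProduct_comm]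
    norm_cast
  -- the score in whitened coordinates
  have hline : ∀ k, ∀ᵐ w ∂NCCES.sphericalLaw M g,
      HasLineDerivAt ℝ (NCCES.logLik g m S W (Ψ w)) (NCCES.whitenedScore g (β k) (A k) w) α
        (Pi.single k 1) := fun k => by
    filter_upwards [NCCES.sphericalLaw_ae_pos hM hg] with w hw
    have hη : 0 < ‖w‖ ^ 2 := by
      have := norm_pos_iff.2 hw.1
      positivity
    have h := NCCES.hasLineDerivAt_logLik (k := k) hM hg (hm k) (hS k) (hW k) hΓ (Ψ w)
      (by rw [heta]; exact hη) (by rw [heta]; exact hw.2)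
    rw [heta, NCCES.etaDeriv_eq hC (haug w) (hβ k) (hA k), htr', Complex.ofReal_re] at h
    convert h using 1
    rw [NCCES.whitenedScore]
    ring
  have hscore : ∀ k, (fun w => NCCES.score g m S W α k (Ψ w)) =ᵐ[NCCES.sphericalLaw M g]
      NCCES.whitenedScore g (β k) (A k) := fun k => by
    filter_upwards [hline k] with w hw
    exact hw.lineDeriv
  have hLp : ∀ k, MemLp (NCCES.whitenedScore g (β k) (A k)) 2 (NCCES.sphericalLaw M g) := fun k =>
    NCCES.memLp_whitenedScore hM hg hQ2 hQ1 (β k) (hAt k)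
  have hprob := NCCES.isProbabilityMeasure_sphericalLaw hM hg
  -- The law is now a pushforward under a measurable equivalence, so each claim is one about
  -- `whitenedScore` under the spherical law.
  rw [hlaw]
  refine ⟨Measure.isProbabilityMeasure_map Ψ.measurable.aemeasurable, fun k => ?_, fun k => ?_,
    fun k l => ?_⟩
  · rw [Ψ.measurableEmbedding.ae_map_iff]
    filter_upwards [hline k] with w hw
    exact hw.lineDifferentiableAt
  · rw [integrable_map_equiv, integral_map_equiv]
    refine ⟨((hLp k).integrable one_le_two).congr (hscore k).symm, ?_⟩
    rw [integral_congr_ae (hscore k), NCCES.integral_whitenedScore hM hg hQ2 hQ1 (β k) (hAt k)]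
  · have hprod : (fun w => NCCES.score g m S W α k (Ψ w) * NCCES.score g m S W α l (Ψ w))
        =ᵐ[NCCES.sphericalLaw M g] fun w =>
        NCCES.whitenedScore g (β k) (A k) w * NCCES.whitenedScore g (β l) (A l) w :=
      (hscore k).mul (hscore l)
    refine ⟨?_, ?_⟩
    · rw [integrable_map_equiv]
      exact ((hLp k).integrable_mul (hLp l)).congr hprod.symm
    · rw [NCCES.fisherInfo, of_apply, hlaw, integral_map_equiv, integral_congr_ae hprod,
        NCCES.integral_whitenedScore_mul_whitenedScore hM hg hQ2 hQ1 (β k) (β l) (hAt k) (hAt l),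
        hinner, htr, htr, htr', htr', htr2]
      push_cast
      ring
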